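/- Let $K$ be a field of characteristic zero, let $\kappa_1,\kappa_2\in K$, and put $\Lambda_l=1/(1-\kappa_l^2)$ for $l=1,2$, where $\Lambda_1,\Lambda_2\notin\{0,1,\infty\}$. Let $\rho_1,\rho_2\in K$ satisfy $$\rho_1=\Lambda_1+\Lambda_2-2\Lambda_1\Lambda_2-1,\qquad \rho_2^2=(1-\Lambda_1-\Lambda_2)^2 .$$ Let $\mathcal E_l$ be the elliptic curve $y^2=x(x-1)(x-\Lambda_l)$ and $\mathcal E_l'$ the two-isogenous elliptic curve $y^2=x\bigl(x^2+2(1-2\Lambda_l)x+1\bigr)$. Consider the following surfaces over $K$, each equipped with a holomorphic two-form. * $\mathcal X$ is the minimal resolution of the double sextic surface (the twisted Legendre pencil) $y^2=z_1z_2(z_1-z_2)(z_1-z_3)(z_3^2+2\rho_1z_2z_3+\rho_2^2z_2^2)$ in $\mathbb P(1,1,1,3)$, with $\omega_{\mathcal X}=dz_1\wedge dz_3/y$ in the chart $z_2=1$. * $\operatorname{Kum}(\mathcal E_1\times\mathcal E_2)^{(\varepsilon)}$, for $\varepsilon\in\{1,2^4\}$, is the minimal resolution of the double cover $y^2=\varepsilon\,x_1z_1(x_1-z_1)(x_1-\Lambda_1z_1)\,x_2z_2(x_2-z_2)(x_2-\Lambda_2z_2)$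 of $\mathbb P^1\times\mathbb P^1$, with two-form $dx_1\wedge dx_2/y$ in the chart $z_1=z_2=1$; for $\varepsilon=1$ it is denoted by $\operatorname{Kum}(\mathcal E_1\times\mathcal E_2)$. * $\operatorname{Kum}(\mathcal E_1'\times\mathcal E_2')$ is the minimal resolution of the double cover $y^2=x_1z_1\bigl(x_1^2+2(1-2\Lambda_1)x_1z_1+z_1^2\bigr)\,x_2z_2\bigl(x_2^2+2(1-2\Lambda_2)x_2z_2+z_2^2\bigr)$ of $\mathbb P^1\times\mathbb P^1$, with two-form $dx_1\wedge dx_2/y$ in the chart $z_1=z_2=1$. Then there are dominant rational maps over $K$ $$\operatorname{Kum}(\mathcal E_1\times\mathcal E_2)\ \overset{f_1}{\dashrightarrow}\ \mathcal X\ \overset{f_2}{\dashrightarrow}\ \operatorname{Kum}(\mathcal E_1'\times\mathcal E_2')\ \overset{f_3}{\dashrightarrow}\ \operatorname{Kum}(\mathcal E_1\times\mathcal E_2)^{(2^4)}$$ with $$f_1^*\,\omega_{\mathcal X}=\omega_{\operatorname{Kum}(\mathcal E_1\times\mathcal E_2)},\qquad f_2^*\,\omega_{\operatorname{Kum}(\mathcal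 E_1'\times\mathcal E_2')}=\omega_{\mathcal X},\qquad f_3^*\,\omega_{\operatorname{Kum}(\mathcal E_1\times\mathcal E_2)^{(2^4)}}=\omega_{\operatorname{Kum}(\mathcal E_1'\times\mathcal E_2')} .$$ Moreover the maps are defined on families over $\mathbb Q(\kappa_1,\kappa_2)$: in the affine coordinates of the charts above, $f_1,f_2,f_3$ are given by quotients of polynomials with rational coefficients in $\kappa_1,\kappa_2$ and the affine coordinates of the source; these polynomials do not depend on $K,\kappa_1,\kappa_2,\rho_1,\rho_2$, and the denominators do not vanish identically on any member of the family. -/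

import Mathlib

open AlgebraicGeometry CategoryTheory MvPolynomial
open scoped DirectSum KaehlerDifferential

universe u

namespace KummerSandwich

noncomputable section

/-! ### Closed subschemes of weighted projective spaces -/

section Grading

variable {K : Type u} [Field K] {A : Type u} [CommRing A] [Algebra K A]
  (𝒜 : ℕ → Submodule K A) [GradedAlgebra 𝒜] (I : HomogeneousIdeal 𝒜)

/-- The grading induced on the quotient of a graded ring by a homogeneous ideal. -/
def quotGrading (n : ℕ) : Submodule K (A ⧸ I.toIdeal) :=
  (𝒜 n).map (Ideal.Quotient.mkₐ K I.toIdeal).toLinearMap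

lemma mk_mem_quotGrading {n : ℕ} {a : A} (ha : a ∈ 𝒜 n) :
    Ideal.Quotient.mk I.toIdeal a ∈ quotGrading 𝒜 I n :=
  ⟨a, ha, rfl⟩

instance quotGrading.gradedMonoid : SetLike.GradedMonoid (quotGrading 𝒜 I) where
  one_mem := ⟨1, SetLike.GradedOne.one_mem, map_one (Ideal.Quotient.mk I.toIdeal)⟩
  mul_mem := by
    rintro i j _ _ ⟨a, ha, rfl⟩ ⟨b, hb, rfl⟩
    exact ⟨a * b, SetLike.GradedMul.mul_mem ha hb, map_mul (Ideal.Quotient.mk I.toIdeal) a b⟩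

/-- The quotient map in degree `n`. -/
def quotMap (n : ℕ) : 𝒜 n →+ quotGrading 𝒜 I n where
  toFun a := ⟨Ideal.Quotient.mk I.toIdeal a, mk_mem_quotGrading 𝒜 I a.2⟩
  map_zero' := Subtype.ext (by simp)
  map_add' a b := Subtype.ext (by simp)

lemma coe_map_quotMap (y : ⨁ n, 𝒜 n) :
    DirectSum.coeAddMonoidHom (quotGrading 𝒜 I) (DirectSum.map (quotMap 𝒜 I) y) =
      Ideal.Quotient.mk I.toIdeal (DirectSum.coeAddMonoidHom 𝒜 y) := by
  induction y using DirectSum.induction_on with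
  | zero => simp
  | of n a => simp [quotMap]
  | add x y hx hy => simp only [map_add, hx, hy]

lemma quotGrading_isInternal : DirectSum.IsInternal (quotGrading 𝒜 I) := by
  constructor
  · rw [injective_iff_map_eq_zero]
    intro x hx
    have hs : Function.Surjective (DirectSum.map (quotMap 𝒜 I)) := by
      rw [DirectSum.map_surjective]
      rintro n ⟨_, a, ha, rfl⟩
      exact ⟨⟨a, ha⟩, rfl⟩
    obtain ⟨y, rfl⟩ := hs x
    rw [coe_map_quotMap, Ideal.Quotient.eq_zero_iff_mem] at hx
    refine DFinsupp.ext fun n => Subtype.ext ?_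
    have h := I.isHomogeneous n hx
    have e : DirectSum.decompose 𝒜 (DirectSum.coeAddMonoidHom 𝒜 y) = y :=
      (DirectSum.decompose 𝒜).apply_symm_apply y
    rw [e] at h
    exact Ideal.Quotient.eq_zero_iff_mem.2 h
  · intro x
    obtain ⟨a, rfl⟩ := Ideal.Quotient.mk_surjective x
    refine ⟨DirectSum.map (quotMap 𝒜 I) (DirectSum.decompose 𝒜 a), ?_⟩
    rw [coe_map_quotMap]
    congr 1
    exact (DirectSum.decompose 𝒜).symm_apply_apply a

instance quotGrading.gradedAlgebra : GradedAlgebra (quotGrading 𝒜 I) where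
  toDecomposition := (quotGrading_isInternal 𝒜 I).chooseDecomposition

end Grading

section WeightedProjective

variable {K : Type u} [Field K] {m : ℕ} (w : Fin m → ℕ)

instance weightedGrading : GradedAlgebra (weightedHomogeneousSubmodule K w) :=
  weightedGradedAlgebra K w

/-- The homogeneous ideal generated by a set of weighted homogeneous polynomials. -/
def idealOf (s : Set (MvPolynomial (Fin m) K)) (hs : ∀ p ∈ s, ∃ n, IsWeightedHomogeneous w p n) :
    HomogeneousIdeal (weightedHomogeneousSubmodule K w) :=
  ⟨Ideal.span s, Ideal.homogeneous_span _ s fun p hp => hs p hp⟩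

variable {w} (I : HomogeneousIdeal (weightedHomogeneousSubmodule K w))

/-- The homogeneous coordinate ring `K[X₀, …, Xₘ₋₁] / I`, graded by the weights. -/
abbrev coordGrading : ℕ → Submodule K (MvPolynomial (Fin m) K ⧸ I.toIdeal) :=
  quotGrading (weightedHomogeneousSubmodule K w) I

/-- The closed subscheme `V₊(I)` of the weighted projective space with weights `w`. -/
def wproj : Scheme.{u} :=
  Proj (coordGrading I)

/-- The structure morphism of `V₊(I)`. -/
def wprojToSpec : wproj I ⟶ Spec (.of K) :=
  Proj.toSpecZero (coordGrading I) ≫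
    Spec.map (CommRingCat.ofHom (algebraMap K (coordGrading I 0)))

lemma var_mem (j : Fin m) :
    Ideal.Quotient.mk I.toIdeal (X j) ∈ coordGrading I (w j) :=
  mk_mem_quotGrading _ _ (isWeightedHomogeneous_X K w j)

/-- The affine coordinate function `Xⱼ / X_c ^ (w j)` on the chart `X_c ≠ 0`, where `X_c` is a
variable of weight one. -/
def affineCoord (c : Fin m) (hc : w c = 1) (j : Fin m) :
    HomogeneousLocalization.Away (coordGrading I) (Ideal.Quotient.mk I.toIdeal (X c)) :=
  HomogeneousLocalization.Away.mk (coordGrading I) (var_mem I c) (w j)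
    (Ideal.Quotient.mk I.toIdeal (X j))
    (by simpa [hc] using var_mem I j)

end WeightedProjective

/-! ### Resolutions, function fields, two-forms, rational maps -/

section Resolutions

variable {K : Type u} [Field K]

/-- A resolution of singularities of a `K`-scheme `Z` (for `K` of characteristic zero): a proper
morphism `g : S ⟶ Z` from an integral smooth `K`-scheme that is an isomorphism over a dense
open subset of `Z` with dense preimage. -/
structure IsResolution {S Z : Scheme.{u}} (z : Z ⟶ Spec (.of K)) (g : S ⟶ Z) : Prop where
  isIntegral : IsIntegral S
  smooth : Smooth (g ≫ z)
  proper : IsProper g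
  birational : ∃ U : Z.Opens, Dense (U : Set Z) ∧ Dense ((g ⁻¹ᵁ U : S.Opens) : Set S) ∧
    IsIso (g ∣_ U)

/-- A minimal resolution of a surface: every other resolution factors through it. -/
structure MinimalResolution {Z : Scheme.{u}} (z : Z ⟶ Spec (.of K)) where
  surface : Scheme.{u}
  map : surface ⟶ Z
  isResolution : IsResolution z map
  minimal : ∀ (T : Scheme.{u}) (g : T ⟶ Z), IsResolution z g → ∃ h : T ⟶ surface, h ≫ map = g

variable {Z Z' : Scheme.{u}} {z : Z ⟶ Spec (.of K)} {z' : Z' ⟶ Spec (.of K)}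

instance MinimalResolution.isIntegral (S : MinimalResolution z) : IsIntegral S.surface :=
  S.isResolution.isIntegral

/-- The structure morphism of the resolved surface. -/
def MinimalResolution.toSpec (S : MinimalResolution z) : S.surface ⟶ Spec (.of K) :=
  S.map ≫ z

/-- The function field `K(S)`. -/
abbrev MinimalResolution.FunctionField (S : MinimalResolution z) : Type u :=
  S.surface.functionField

/-- The generic point `Spec K(S) ⟶ S`. -/
def MinimalResolution.generic (S : MinimalResolution z) :
    Spec (.of S.FunctionField) ⟶ S.surface :=
  S.surface.fromSpecStalk (genericPoint S.surface)

/-- The constants `K ⊆ K(S)`. -/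
instance MinimalResolution.algebra (S : MinimalResolution z) : Algebra K S.FunctionField :=
  (Spec.preimage (S.generic ≫ S.toSpec)).hom.toAlgebra

/-- Rational two-forms of a function field `F` over `K`. -/
abbrev TwoForm (K F : Type u) [Field K] [Field F] [Algebra K F] : Type u :=
  ⋀[F]^2 Ω[F⁄K]

/-- The two-form `dx ∧ dy / t`. -/
def natForm (K : Type u) {F : Type u} [Field K] [Field F] [Algebra K F] (x y t : F) :
    TwoForm K F :=
  t⁻¹ • exteriorPower.ιMulti F 2 ![KaehlerDifferential.D K F x, KaehlerDifferential.D K F y]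

/-- Pullback of two-forms along a homomorphism of function fields; it is the additive map with
`a • (dx ∧ dy) ↦ φ a • (d(φ x) ∧ d(φ y))`. -/
def pullbackTwoForm {F L : Type u} [Field F] [Field L] [Algebra K F] [Algebra K L]
    (φ : F →ₐ[K] L) : TwoForm K F →+ TwoForm K L :=
  letI : Algebra F L := φ.toRingHom.toAlgebra
  haveI : IsScalarTower K F L := IsScalarTower.of_algebraMap_eq fun k => (φ.commutes k).symm
  (exteriorPower.alternatingMapLinearEquiv
    { toMultilinearMap := ((exteriorPower.ιMulti L 2 (M := Ω[L⁄K])).toMultilinearMap.restrictScalars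
        F).compLinearMap fun _ => KaehlerDifferential.map K K F L
      map_eq_zero_of_eq' := fun _ _ _ h hij =>
        (exteriorPower.ιMulti L 2).map_eq_zero_of_eq _
          (congrArg (KaehlerDifferential.map K K F L) h) hij }).toAddMonoidHom

lemma pullbackTwoForm_smul_ι {F L : Type u} [Field F] [Field L] [Algebra K F] [Algebra K L]
    (φ : F →ₐ[K] L) (a x y : F) :
    pullbackTwoForm φ (a • exteriorPower.ιMulti F 2
        ![KaehlerDifferential.D K F x, KaehlerDifferential.D K F y]) =
      φ a • exteriorPower.ιMulti L 2
        ![KaehlerDifferential.D K L (φ x), KaehlerDifferential.D K L (φ y)] := by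
  let : Algebra F L := φ.toRingHom.toAlgebra
  have : IsScalarTower K F L := IsScalarTower.of_algebraMap_eq fun k => (φ.commutes k).symm
  refine ((exteriorPower.alternatingMapLinearEquiv _).map_smul a _).trans ?_
  rw [exteriorPower.alternatingMapLinearEquiv_apply_ιMulti, ← algebraMap_smul L]
  change φ a • exteriorPower.ιMulti L 2 _ = _
  congr 2
  ext i
  fin_cases i <;> exact KaehlerDifferential.map_D K K F L _

/-- A dominant rational map `S ⤏ T` over `K`, together with the (uniquely determined) homomorphism
`K(T) → K(S)` of function fields by which it acts on the generic points. -/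
structure DominantMap (S : MinimalResolution z) (T : MinimalResolution z') where
  toRationalMap : S.surface ⤏ T.surface
  isOver : toRationalMap.compHom T.toSpec = S.toSpec.toRationalMap
  isDominant : toRationalMap.IsDominant
  comap : T.FunctionField →ₐ[K] S.FunctionField
  comap_spec : Spec.map (CommRingCat.ofHom comap.toRingHom) ≫ T.generic =
    toRationalMap.fromFunctionField

/-- The pullback `f^*` of rational two-forms. -/
def DominantMap.pullback {S : MinimalResolution z} {T : MinimalResolution z'}
    (f : DominantMap S T) : TwoForm K T.FunctionField →+ TwoForm K S.FunctionField :=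
  pullbackTwoForm f.comap

/-- The value in `F` of a polynomial over `ℚ` in `κ₁, κ₂` and three further variables. -/
def evalFamily {F : Type u} [Field F] [Algebra K F] [CharZero K] (κ₁ κ₂ : K) (x : Fin 3 → F)
    (P : MvPolynomial (Fin 5) ℚ) : F :=
  P.eval₂ ((algebraMap K F).comp (algebraMap ℚ K))
    ![algebraMap K F κ₁, algebraMap K F κ₂, x 0, x 1, x 2]

/-- In terms of coordinate functions `x` on `S` and `t` on `T`, the rational map `f` is given by
`tᵢ = Nᵢ(κ₁, κ₂, x) / Dᵢ(κ₁, κ₂, x)`. -/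
def DominantMap.GivenBy [CharZero K] {S : MinimalResolution z} {T : MinimalResolution z'}
    (f : DominantMap S T) (κ₁ κ₂ : K) (x : Fin 3 → S.FunctionField) (t : Fin 3 → T.FunctionField)
    (N D : Fin 3 → MvPolynomial (Fin 5) ℚ) : Prop :=
  ∀ i, evalFamily κ₁ κ₂ x (D i) ≠ 0 ∧
    f.comap (t i) = evalFamily κ₁ κ₂ x (N i) / evalFamily κ₁ κ₂ x (D i)

open Classical in
/-- The rational function `Xⱼ / X_c ^ (w j)` on `V₊(I)`, pulled back to a resolution `S`.
(The chart `X_c ≠ 0` has a nonempty preimage whenever it is dense in `V₊(I)`.) -/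
def MinimalResolution.coord {m : ℕ} {w : Fin m → ℕ}
    {I : HomogeneousIdeal (weightedHomogeneousSubmodule K w)}
    (S : MinimalResolution (wprojToSpec I)) (c : Fin m) (hc : w c = 1) (j : Fin m) :
    S.FunctionField :=
  let U : (wproj I).Opens := Proj.basicOpen (coordGrading I) (Ideal.Quotient.mk I.toIdeal (X c))
  if _ : Nonempty (S.map ⁻¹ᵁ U) then
    (S.surface.germToFunctionField (S.map ⁻¹ᵁ U)).hom
      ((S.map.app U).hom ((Proj.awayToSection (coordGrading I) _).hom (affineCoord I c hc j)))
  else 0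

end Resolutions

/-! ### The surfaces -/

section Surfaces

variable {K : Type u} [Field K]

/-- The elliptic curve `y² = x (x - 1) (x - Λ)`. -/
def legendreCurve (Λ : K) : WeierstrassCurve K :=
  ⟨0, -(1 + Λ), 0, Λ, 0⟩

/-- The elliptic curve `y² = x (x² + 2 (1 - 2 Λ) x + 1)`, the quotient of `y² = x (x - 1) (x - Λ)`
by the subgroup generated by the point `(Λ, 0)`. -/
def isogenousCurve (Λ : K) : WeierstrassCurve K :=
  ⟨0, 2 * (1 - 2 * Λ), 0, 1, 0⟩

lemma legendreCurve_equation (Λ x y : K) :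
    (legendreCurve Λ).toAffine.Equation x y ↔ y ^ 2 = x * (x - 1) * (x - Λ) := by
  rw [WeierstrassCurve.Affine.equation_iff]
  simp only [legendreCurve]
  constructor <;> intro h <;> linear_combination h

/-- The two-isogeny with kernel generated by `(Λ, 0)`, on affine points. -/
lemma isogenousCurve_equation {Λ x y : K} (h : (legendreCurve Λ).toAffine.Equation x y)
    (hx : x ≠ Λ) :
    (isogenousCurve Λ).toAffine.Equation (y ^ 2 / (x - Λ) ^ 2)
      (y * ((x - Λ) ^ 2 - Λ * (Λ - 1)) / (x - Λ) ^ 2) := by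
  rw [legendreCurve_equation] at h
  rw [WeierstrassCurve.Affine.equation_iff]
  simp only [isogenousCurve]
  have hx' : x - Λ ≠ 0 := sub_ne_zero.2 hx
  field_simp
  have e : y ^ 4 + y ^ 2 * (2 * (1 - 2 * Λ)) * (x - Λ) ^ 2 + (x - Λ) ^ 4 =
      ((x - Λ) ^ 2 - Λ * (Λ - 1)) ^ 2 * (x - Λ) ^ 2 := by
    have h4 : y ^ 4 = (x * (x - 1) * (x - Λ)) ^ 2 := by rw [← h]; ring
    rw [h4, h]
    ring
  linear_combination -y ^ 2 * e

/-- In the Segre coordinates `X₀ = x₁x₂, X₁ = x₁z₂, X₂ = z₁x₂, X₃ = z₁z₂` of `ℙ¹ × ℙ¹`, the form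
`x₁z₁(x₁² + a x₁z₁ + b z₁²) x₂z₂(x₂² + a' x₂z₂ + b' z₂²)` of bidegree `(4, 4)` attached to the curves
`E₁ : y² = x(x² + a x + b)` and `E₂ : y² = x(x² + a' x + b')`. -/
def branchForm (E₁ E₂ : WeierstrassCurve K) : MvPolynomial (Fin 5) K :=
  X 0 * X 3 *
    (X 0 ^ 2 + C E₂.a₂ * (X 0 * X 1) + C E₂.a₄ * X 1 ^ 2 +
      C E₁.a₂ * (X 0 * X 2) + C (E₁.a₂ * E₂.a₂) * (X 0 * X 3) + C (E₁.a₂ * E₂.a₄) * (X 1 * X 3) +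
      C E₁.a₄ * X 2 ^ 2 + C (E₁.a₄ * E₂.a₂) * (X 2 * X 3) + C (E₁.a₄ * E₂.a₄) * X 3 ^ 2)

lemma eval_branchForm (E₁ E₂ : WeierstrassCurve K) (x₁ z₁ x₂ z₂ y : K) :
    eval ![x₁ * x₂, x₁ * z₂, z₁ * x₂, z₁ * z₂, y] (branchForm E₁ E₂) =
      x₁ * z₁ * (x₁ ^ 2 + E₁.a₂ * x₁ * z₁ + E₁.a₄ * z₁ ^ 2) *
        (x₂ * z₂ * (x₂ ^ 2 + E₂.a₂ * x₂ * z₂ + E₂.a₄ * z₂ ^ 2)) := by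
  simp [branchForm]
  ring

lemma eval_branchForm_legendre (Λ₁ Λ₂ x₁ z₁ x₂ z₂ y : K) :
    eval ![x₁ * x₂, x₁ * z₂, z₁ * x₂, z₁ * z₂, y]
        (branchForm (legendreCurve Λ₁) (legendreCurve Λ₂)) =
      x₁ * z₁ * (x₁ - z₁) * (x₁ - Λ₁ * z₁) * (x₂ * z₂ * (x₂ - z₂) * (x₂ - Λ₂ * z₂)) := by
  rw [eval_branchForm]
  simp only [legendreCurve]
  ring

lemma eval_branchForm_isogenous (Λ₁ Λ₂ x₁ z₁ x₂ z₂ y : K) :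
    eval ![x₁ * x₂, x₁ * z₂, z₁ * x₂, z₁ * z₂, y]
        (branchForm (isogenousCurve Λ₁) (isogenousCurve Λ₂)) =
      x₁ * z₁ * (x₁ ^ 2 + 2 * (1 - 2 * Λ₁) * x₁ * z₁ + z₁ ^ 2) *
        (x₂ * z₂ * (x₂ ^ 2 + 2 * (1 - 2 * Λ₂) * x₂ * z₂ + z₂ ^ 2)) := by
  rw [eval_branchForm]
  simp only [isogenousCurve]
  ring

/-- Weights of `ℙ(1, 1, 1, 1, 2)`, with coordinates `x₁x₂, x₁z₂, z₁x₂, z₁z₂, y`. -/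
abbrev quadricWeight : Fin 5 → ℕ := ![1, 1, 1, 1, 2]

/-- Weights of `ℙ(1, 1, 1, 3)`, with coordinates `z₁, z₂, z₃, y`. -/
abbrev sexticWeight : Fin 4 → ℕ := ![1, 1, 1, 3]

lemma isWeightedHomogeneous_C_mul {m : ℕ} {w : Fin m → ℕ} (a : K) {p : MvPolynomial (Fin m) K}
    {n : ℕ} (hp : IsWeightedHomogeneous w p n) : IsWeightedHomogeneous w (C a * p) n := by
  simpa using (isWeightedHomogeneous_C w a).mul hp

lemma branchForm_homogeneous (E₁ E₂ : WeierstrassCurve K) :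
    IsWeightedHomogeneous quadricWeight (branchForm E₁ E₂) 4 := by
  have h : ∀ i : Fin 5, IsWeightedHomogeneous quadricWeight (X i : MvPolynomial (Fin 5) K)
      (quadricWeight i) := isWeightedHomogeneous_X K _
  have hm : ∀ i j : Fin 5, quadricWeight i = 1 → quadricWeight j = 1 →
      IsWeightedHomogeneous quadricWeight (X i * X j : MvPolynomial (Fin 5) K) 2 := by
    intro i j hi hj
    simpa [hi, hj] using (h i).mul (h j)
  have hq : ∀ i : Fin 5, quadricWeight i = 1 →
      IsWeightedHomogeneous quadricWeight (X i ^ 2 : MvPolynomial (Fin 5) K) 2 := by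
    intro i hi
    simpa [sq] using hm i i hi hi
  refine (hm 0 3 rfl rfl).mul (n := 2) ?_
  refine IsWeightedHomogeneous.add ?_ (isWeightedHomogeneous_C_mul _ (hq 3 rfl))
  refine IsWeightedHomogeneous.add ?_ (isWeightedHomogeneous_C_mul _ (hm 2 3 rfl rfl))
  refine IsWeightedHomogeneous.add ?_ (isWeightedHomogeneous_C_mul _ (hq 2 rfl))
  refine IsWeightedHomogeneous.add ?_ (isWeightedHomogeneous_C_mul _ (hm 1 3 rfl rfl))
  refine IsWeightedHomogeneous.add ?_ (isWeightedHomogeneous_C_mul _ (hm 0 3 rfl rfl))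
  refine IsWeightedHomogeneous.add ?_ (isWeightedHomogeneous_C_mul _ (hm 0 2 rfl rfl))
  refine IsWeightedHomogeneous.add ?_ (isWeightedHomogeneous_C_mul _ (hq 1 rfl))
  exact (hq 0 rfl).add (isWeightedHomogeneous_C_mul _ (hm 0 1 rfl rfl))

lemma isWeightedHomogeneous_sub {m : ℕ} {w : Fin m → ℕ} {p q : MvPolynomial (Fin m) K}
    {n : ℕ} (hp : IsWeightedHomogeneous w p n) (hq : IsWeightedHomogeneous w q n) :
    IsWeightedHomogeneous w (p - q) n :=
  (weightedHomogeneousSubmodule K w n).sub_mem hp hq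

/-- The homogeneous ideal of the double quadric surface. -/
def doubleQuadricIdeal (E₁ E₂ : WeierstrassCurve K) (ε : K) :
    HomogeneousIdeal (weightedHomogeneousSubmodule K quadricWeight) :=
  idealOf quadricWeight {X 0 * X 3 - X 1 * X 2, X 4 ^ 2 - C ε * branchForm E₁ E₂} (by
    have h : ∀ i : Fin 5, IsWeightedHomogeneous quadricWeight (X i : MvPolynomial (Fin 5) K)
      (quadricWeight i) := isWeightedHomogeneous_X K _
    rintro p (rfl | rfl)
    · exact ⟨2, isWeightedHomogeneous_sub ((h 0).mul (h 3)) ((h 1).mul (h 2))⟩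
    · exact ⟨4, isWeightedHomogeneous_sub ((h 4).pow 2)
        (isWeightedHomogeneous_C_mul _ (branchForm_homogeneous E₁ E₂))⟩)

/-- The double cover `y² = ε x₁z₁(x₁² + a x₁z₁ + b z₁²) x₂z₂(x₂² + a' x₂z₂ + b' z₂²)` of `ℙ¹ × ℙ¹`, a
model of the quotient of `E₁ × E₂` by `-1`, twisted by `ε`, for elliptic curves
`E₁ : y² = x(x² + a x + b)` and `E₂ : y² = x(x² + a' x + b')`. -/
abbrev doubleQuadric (E₁ E₂ : WeierstrassCurve K) (ε : K) :
    wproj (doubleQuadricIdeal E₁ E₂ ε) ⟶ Spec (.of K) :=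
  wprojToSpec (doubleQuadricIdeal E₁ E₂ ε)

/-- The Kummer surface `Kum(E₁ × E₂)^(ε)`: the minimal resolution of the double quadric. -/
abbrev Kum (E₁ E₂ : WeierstrassCurve K) (ε : K) :=
  MinimalResolution (doubleQuadric E₁ E₂ ε)

/-- The coordinate functions `x₁, x₂, y` of the chart `z₁ = z₂ = 1`. -/
def Kum.coords {E₁ E₂ : WeierstrassCurve K} {ε : K} (S : Kum E₁ E₂ ε) :
    Fin 3 → S.FunctionField :=
  ![S.coord 3 rfl 1, S.coord 3 rfl 2, S.coord 3 rfl 4]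

/-- The two-form `dx₁ ∧ dx₂ / y`. -/
def Kum.form {E₁ E₂ : WeierstrassCurve K} {ε : K} (S : Kum E₁ E₂ ε) :
    TwoForm K S.FunctionField :=
  natForm K (Kum.coords S 0) (Kum.coords S 1) (Kum.coords S 2)

/-- The homogeneous ideal of the twisted Legendre pencil. -/
def legendrePencilIdeal (ρ₁ ρ₂ : K) :
    HomogeneousIdeal (weightedHomogeneousSubmodule K sexticWeight) :=
  idealOf sexticWeight {X 3 ^ 2 - X 0 * X 1 * (X 0 - X 1) * (X 0 - X 2) *
      (X 2 ^ 2 + C (2 * ρ₁) * (X 1 * X 2) + C (ρ₂ ^ 2) * X 1 ^ 2)} (by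
    have h : ∀ i : Fin 4, IsWeightedHomogeneous sexticWeight (X i : MvPolynomial (Fin 4) K)
      (sexticWeight i) := isWeightedHomogeneous_X K _
    rintro p rfl
    refine ⟨6, isWeightedHomogeneous_sub ((h 3).pow 2) ?_⟩
    refine ((((h 0).mul (h 1)).mul (isWeightedHomogeneous_sub (h 0) (h 1))).mul
      (isWeightedHomogeneous_sub (h 0) (h 2))).mul (n := 2) ?_
    exact (((h 2).pow 2).add (isWeightedHomogeneous_C_mul _ ((h 1).mul (h 2)))).add
      (isWeightedHomogeneous_C_mul _ ((h 1).pow 2)))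

/-- The double sextic `y² = z₁z₂(z₁ - z₂)(z₁ - z₃)(z₃² + 2ρ₁z₂z₃ + ρ₂²z₂²)`. -/
abbrev legendrePencil (ρ₁ ρ₂ : K) : wproj (legendrePencilIdeal ρ₁ ρ₂) ⟶ Spec (.of K) :=
  wprojToSpec (legendrePencilIdeal ρ₁ ρ₂)

/-- The K3 surface of the twisted Legendre pencil: the minimal resolution of the double sextic. -/
abbrev LegendreK3 (ρ₁ ρ₂ : K) :=
  MinimalResolution (legendrePencil ρ₁ ρ₂)

/-- The coordinate functions `z₁, z₃, y` of the chart `z₂ = 1`. -/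
def LegendreK3.coords {ρ₁ ρ₂ : K} (S : LegendreK3 ρ₁ ρ₂) : Fin 3 → S.FunctionField :=
  ![S.coord 1 rfl 0, S.coord 1 rfl 2, S.coord 1 rfl 3]

/-- The two-form `dz₁ ∧ dz₃ / y`. -/
def LegendreK3.form {ρ₁ ρ₂ : K} (S : LegendreK3 ρ₁ ρ₂) : TwoForm K S.FunctionField :=
  natForm K (LegendreK3.coords S 0) (LegendreK3.coords S 1) (LegendreK3.coords S 2)

end Surfaces

end

end KummerSandwich

/-! A dominant rational map of integral surfaces over K amounts to a K-homomorphism of function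
fields in the opposite direction (`exists_dominantMap`), so only the generic points of the
resolutions matter. A resolution is an isomorphism near its generic point, and each surface has a
chart that is an affine double plane y² = f(x₀, x₁) with f of odd degree in x₀. Its function field
is therefore K(x₀, x₁)(√f) (`IsDoublePlaneField`), and a homomorphism from it to a field L is a
solution of y² = f in L with x₀, x₁ algebraically independent.

The independence follows from the statement on two-forms: a point that pulls the standard form back
to the standard, nonzero form has dx₀ ∧ dx₁ ≠ 0, and in characteristic zero this forces
independence. So each map reduces to an equation, a Jacobian identity and some nonvanishing
(`exists_dominantMap_of_point`).

For the formulas put a = κ₁², b = κ₂², eᵢ = 1 - κᵢ², so that Λᵢ = 1/eᵢ, and c = e₁e₂t - (1 + ab)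
with t = z₃. The quadratic factor of the pencil is then (c² - 4ab)/(e₁e₂)². For f₁, let wᵢ = 1 -
eᵢxᵢ and s = w₁/w₂. The choice c = -(bs + a/s) makes c² - 4ab = (bs - a/s)² a square, which removes
the quadratic twist from the Legendre pencil. For f₂, x₁x₂ = x(x - 1)/(x - t) comes from the
two-isogeny of the Legendre fibre with kernel (t, 0), and x₁ = N/D where (N, D) is the image of a
vector under c + κ₂J with J² = 4a. Multiplicativity of the norm c² - 4ab gives the equation
(`isogenous_equation_of_pencil`). The map f₃ is the product of the dual two-isogenies x ↦ (x +
1)²/(4x). Preserving the form rescales y by 4, whence the twist 2⁴. -/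

namespace KummerSandwich

noncomputable section

/-! ### Affine double planes y² = f(x₀, x₁) -/

section DoublePlane

variable {K : Type u} [Field K]

/-- Parity of the degree in the variable i: it is even on the left and odd on the right unless c =
0. This is the irreducibility of y² - f. -/
lemma eq_zero_of_sq_eq_mul_sq {σ : Type*} {f b c : MvPolynomial σ K} {i : σ}
    (hf : Odd (degreeOf i f)) (h : b ^ 2 = f * c ^ 2) : c = 0 := by
  by_contra hc
  have hf0 : f ≠ 0 := by
    rintro rfl
    simp at hf
  have hb : b ≠ 0 := by
    rintro rfl
    rw [zero_pow two_ne_zero] at h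
    exact mul_ne_zero hf0 (pow_ne_zero 2 hc) h.symm
  have e := congrArg (degreeOf i) h
  rw [degreeOf_pow_eq i b 2 hb, degreeOf_mul_eq hf0 (pow_ne_zero 2 hc),
    degreeOf_pow_eq i c 2 hc] at e
  obtain ⟨k, hk⟩ := hf
  omega

lemma map_aeval_pair {A B : Type*} [CommRing A] [Algebra K A] [CommRing B] [Algebra K B]
    (ψ : A →ₐ[K] B) (x y : A) (q : MvPolynomial (Fin 2) K) :
    ψ (aeval ![x, y] q) = aeval ![ψ x, ψ y] q := by
  have h : ψ.comp (aeval ![x, y]) = aeval ![ψ x, ψ y] := by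
    ext i
    fin_cases i <;> simp
  exact congr($h q)

/-- A point `(x₀, x₁, y)` on the double plane `y² = f(x₀, x₁)` with values in a `K`-algebra. -/
def OnDoublePlane (f : MvPolynomial (Fin 2) K) {A : Type*} [CommRing A] [Algebra K A]
    (a : Fin 3 → A) : Prop :=
  a 2 ^ 2 = aeval ![a 0, a 1] f

variable {f : MvPolynomial (Fin 2) K} {A : Type*} [CommRing A] [Algebra K A] {a : Fin 3 → A}

lemma OnDoublePlane.exists_normalForm (ha : OnDoublePlane f a)
    (hgen : Algebra.adjoin K (Set.range a) = ⊤) (x : A) :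
    ∃ b c : MvPolynomial (Fin 2) K,
      x = aeval ![a 0, a 1] b + aeval ![a 0, a 1] c * a 2 := by
  have hx : x ∈ Algebra.adjoin K (Set.range a) := hgen ▸ Algebra.mem_top
  induction hx using Algebra.adjoin_induction with
  | mem x hx =>
    obtain ⟨i, rfl⟩ := hx
    fin_cases i
    · exact ⟨X 0, 0, by simp⟩
    · exact ⟨X 1, 0, by simp⟩
    · exact ⟨0, 1, by simp⟩
  | algebraMap r => exact ⟨C r, 0, by simp⟩
  | add x y _ _ hx hy =>
    obtain ⟨b, c, rfl⟩ := hx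
    obtain ⟨b', c', rfl⟩ := hy
    exact ⟨b + b', c + c', by simp only [map_add]; ring⟩
  | mul x y _ _ hx hy =>
    obtain ⟨b, c, rfl⟩ := hx
    obtain ⟨b', c', rfl⟩ := hy
    refine ⟨b * b' + c * c' * f, b * c' + c * b', ?_⟩
    simp only [map_add, map_mul]
    rw [OnDoublePlane] at ha
    linear_combination (aeval ![a 0, a 1] c) * (aeval ![a 0, a 1] c') * ha

lemma OnDoublePlane.map (ha : OnDoublePlane f a) {B : Type*} [CommRing B] [Algebra K B]
    (ψ : A →ₐ[K] B) : OnDoublePlane f (ψ ∘ a) := by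
  have h := congrArg ψ ha
  rwa [map_pow, map_aeval_pair] at h

/-- A homomorphism from the coordinate ring of an irreducible double plane which keeps the two
base coordinates algebraically independent is injective. -/
lemma OnDoublePlane.injective (ha : OnDoublePlane f a)
    (hgen : Algebra.adjoin K (Set.range a) = ⊤) {i : Fin 2} (hf : Odd (degreeOf i f))
    {L : Type*} [Field L] [Algebra K L] (ψ : A →ₐ[K] L)
    (hψ : AlgebraicIndependent K ![ψ (a 0), ψ (a 1)]) : Function.Injective ψ := by
  rw [injective_iff_map_eq_zero]
  intro x hx
  obtain ⟨b, c, rfl⟩ := ha.exists_normalForm hgen x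
  have h2 := ha.map ψ
  simp only [OnDoublePlane, Function.comp_apply] at h2
  rw [map_add, map_mul, map_aeval_pair, map_aeval_pair] at hx
  -- Multiplying b + cy = 0 by the conjugate b - cy gives a relation between the base coordinates
  -- alone, which independence lifts to polynomials.
  have h : b ^ 2 = f * c ^ 2 := by
    apply hψ
    simp only [map_mul, map_pow]
    rw [← h2]
    linear_combination (aeval ![ψ (a 0), ψ (a 1)] b - aeval ![ψ (a 0), ψ (a 1)] c * ψ (a 2)) * hx
  have hc := eq_zero_of_sq_eq_mul_sq hf h
  have hb : b = 0 := by
    rw [hc] at h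
    simpa using h
  simp [hb, hc]

/-- Every double plane has a generic point. -/
lemma exists_generic_onDoublePlane (f : MvPolynomial (Fin 2) K) :
    ∃ (L : Type u) (_ : Field L) (_ : Algebra K L) (p : Fin 3 → L), OnDoublePlane f p ∧
      AlgebraicIndependent K ![p 0, p 1] := by
  let F := FractionRing (MvPolynomial (Fin 2) K)
  let ι : MvPolynomial (Fin 2) K →ₐ[K] AlgebraicClosure F :=
    IsScalarTower.toAlgHom K (MvPolynomial (Fin 2) K) (AlgebraicClosure F)
  have hι : Function.Injective ι := by
    have : Function.Injective ((algebraMap F (AlgebraicClosure F)).comp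
        (algebraMap (MvPolynomial (Fin 2) K) F)) :=
      (algebraMap F (AlgebraicClosure F)).injective.comp (IsFractionRing.injective _ F)
    exact this
  obtain ⟨t, ht⟩ := IsAlgClosed.exists_pow_nat_eq (ι f) (n := 2) two_pos
  have e : aeval ![ι (X 0), ι (X 1)] = ι := by
    ext i
    fin_cases i <;> simp
  refine ⟨AlgebraicClosure F, inferInstance, inferInstance, ![ι (X 0), ι (X 1), t], ?_, ?_⟩
  · simp only [OnDoublePlane, Matrix.cons_val]
    rw [ht, e]
  · simp only [Matrix.cons_val_zero, Matrix.cons_val_one, AlgebraicIndependent]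
    rw [e]
    exact hι

end DoublePlane

/-! ### Charts of weighted projective schemes at a variable of weight one -/

section Chart

variable {K : Type u} [Field K] {m : ℕ} {w : Fin m → ℕ}
  (I : HomogeneousIdeal (weightedHomogeneousSubmodule K w))

/-- The coordinate ring of the chart `X_c ≠ 0` of `V₊(I)`. -/
abbrev ChartRing (c : Fin m) : Type u :=
  HomogeneousLocalization.Away (coordGrading I) (Ideal.Quotient.mk I.toIdeal (X c))

instance ChartRing.algebra (c : Fin m) : Algebra K (ChartRing I c) :=
  ((HomogeneousLocalization.fromZeroRingHom (coordGrading I) _).comp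
    (algebraMap K (coordGrading I 0))).toAlgebra

/-- The inclusion of the chart ring in the localised homogeneous coordinate ring. -/
def ChartRing.val (c : Fin m) : ChartRing I c →ₐ[K]
    Localization.Away (Ideal.Quotient.mk I.toIdeal (X c)) where
  __ := algebraMap (ChartRing I c) (Localization.Away (Ideal.Quotient.mk I.toIdeal (X c)))
  commutes' r := by
    change Localization.mk (algebraMap K (coordGrading I 0) r).1 1 = _
    rw [IsScalarTower.algebraMap_apply K (MvPolynomial (Fin m) K ⧸ I.toIdeal)
      (Localization.Away (Ideal.Quotient.mk I.toIdeal (X c)))]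
    exact Localization.mk_one_eq_algebraMap _

lemma ChartRing.val_injective (c : Fin m) : Function.Injective (ChartRing.val I c) :=
  HomogeneousLocalization.val_injective _

variable (c : Fin m) (hc : w c = 1)

lemma ChartRing.val_affineCoord (j : Fin m) :
    ChartRing.val I c (affineCoord I c hc j) * algebraMap _ _
      (Ideal.Quotient.mk I.toIdeal (X c)) ^ w j =
      algebraMap _ _ (Ideal.Quotient.mk I.toIdeal (X j)) := by
  change Localization.mk _ _ * _ = _
  rw [← Localization.mk_one_eq_algebraMap, ← Localization.mk_one_eq_algebraMap, Localization.mk_pow,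
    Localization.mk_mul, Localization.mk_eq_mk_iff, Localization.r_iff_exists]
  exact ⟨1, by simp; ring⟩

/-- Evaluating a weighted homogeneous polynomial at the affine coordinates dehomogenises it. -/
lemma ChartRing.aeval_affineCoord {p : MvPolynomial (Fin m) K} {n : ℕ}
    (hp : IsWeightedHomogeneous w p n) :
    aeval (affineCoord I c hc) p = HomogeneousLocalization.Away.mk (coordGrading I) (var_mem I c) n
      (Ideal.Quotient.mk I.toIdeal p)
      (by simpa [hc] using mk_mem_quotGrading _ I hp) := by
  apply ChartRing.val_injective I c
  set u := algebraMap _ (Localization.Away (Ideal.Quotient.mk I.toIdeal (X c)))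
    (Ideal.Quotient.mk I.toIdeal (X c)) with hu
  have hu' : IsUnit u := IsLocalization.Away.algebraMap_isUnit _
  refine (hu'.pow n).mul_right_cancel ?_
  have e : ChartRing.val I c (HomogeneousLocalization.Away.mk (coordGrading I) (var_mem I c) n
      (Ideal.Quotient.mk I.toIdeal p) (by simpa [hc] using mk_mem_quotGrading _ I hp)) * u ^ n =
      algebraMap _ _ (Ideal.Quotient.mk I.toIdeal p) := by
    change Localization.mk _ _ * _ = _
    rw [hu, ← Localization.mk_one_eq_algebraMap, ← Localization.mk_one_eq_algebraMap,
      Localization.mk_pow, Localization.mk_mul, Localization.mk_eq_mk_iff,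
      Localization.r_iff_exists]
    exact ⟨1, by simp; ring⟩
  rw [e]
  conv_rhs => rw [← aeval_X_left_apply p]
  rw [aeval_def, aeval_def, eval₂_eq', eval₂_eq', map_sum, Finset.sum_mul, map_sum, map_sum]
  refine Finset.sum_congr rfl fun d hd => ?_
  have hw := hp (mem_support_iff.1 hd)
  rw [Finsupp.weight_apply, Finsupp.sum_fintype _ _ (by simp)] at hw
  -- Each monomial has weight n, so uⁿ splits into one factor u ^ (w j) for every occurrence of Xⱼ.
  rw [← hw, ← Finset.prod_pow_eq_pow_sum]
  simp only [map_mul, map_prod, map_pow, AlgHom.commutes]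
  rw [mul_assoc, ← Finset.prod_mul_distrib]
  congr 1
  refine Finset.prod_congr rfl fun j _ => ?_
  rw [← ChartRing.val_affineCoord I c hc j, ← hu, mul_pow, ← pow_mul]
  congr 2
  simp [mul_comm]

lemma ChartRing.aeval_eq_zero {p : MvPolynomial (Fin m) K} {n : ℕ}
    (hp : IsWeightedHomogeneous w p n) (hpI : p ∈ I.toIdeal) :
    aeval (affineCoord I c hc) p = 0 := by
  rw [ChartRing.aeval_affineCoord I c hc hp]
  exact HomogeneousLocalization.mk_eq_zero_of_num _
    (Subtype.ext (Ideal.Quotient.eq_zero_iff_mem.2 hpI))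

lemma ChartRing.affineCoord_self : affineCoord I c hc c = 1 := by
  have h := ChartRing.aeval_affineCoord I c hc (isWeightedHomogeneous_X K w c)
  rw [aeval_X] at h
  apply ChartRing.val_injective I c
  have h1 := ChartRing.val_affineCoord I c hc c
  rw [hc, pow_one] at h1
  rw [map_one]
  exact (IsLocalization.Away.algebraMap_isUnit _).mul_right_cancel (h1.trans (one_mul _).symm)

lemma ChartRing.adjoin_affineCoord :
    Algebra.adjoin K (Set.range (affineCoord I c hc)) = ⊤ := by
  rw [eq_top_iff]
  rintro x -
  obtain ⟨n, _, ⟨p, hp, rfl⟩, rfl⟩ :=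
    HomogeneousLocalization.Away.mk_surjective (coordGrading I) (var_mem I c) x
  rw [Algebra.adjoin_range_eq_range_aeval]
  refine ⟨p, ?_⟩
  have hp' : IsWeightedHomogeneous w p n := by simpa [hc] using hp
  exact ChartRing.aeval_affineCoord I c hc hp'

/-- A common zero `q` of `I` with `q_c = 1` is a point of the chart `X_c ≠ 0`. -/
lemma ChartRing.exists_algHom {L : Type*} [CommRing L] [Algebra K L] (q : Fin m → L)
    (hq : ∀ p ∈ I.toIdeal, aeval q p = 0) (hqc : q c = 1) :
    ∃ ψ : ChartRing I c →ₐ[K] L, ∀ j, ψ (affineCoord I c hc j) = q j := by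
  let φ : (MvPolynomial (Fin m) K ⧸ I.toIdeal) →ₐ[K] L := Ideal.Quotient.liftₐ _ (aeval q) hq
  have hφ : ∀ j, φ (Ideal.Quotient.mk I.toIdeal (X j)) = q j := fun j => by
    change aeval q (X j) = q j
    simp
  have hu : ∀ y : Submonoid.powers (Ideal.Quotient.mk I.toIdeal (X c)), IsUnit (φ y) := by
    rintro ⟨_, n, rfl⟩
    simp [hφ, hqc]
  let Φ : Localization.Away (Ideal.Quotient.mk I.toIdeal (X c)) →ₐ[K] L :=
    IsLocalization.liftAlgHom (M := Submonoid.powers (Ideal.Quotient.mk I.toIdeal (X c)))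
      (f := φ) hu
  have hΦ : ∀ y, Φ (algebraMap _ _ y) = φ y := fun y => by
    simp only [Φ, IsLocalization.liftAlgHom_apply, IsLocalization.lift_eq]
    rfl
  refine ⟨Φ.comp (ChartRing.val I c), fun j => ?_⟩
  have h := congrArg Φ (ChartRing.val_affineCoord I c hc j)
  rwa [map_mul, map_pow, hΦ, hΦ, hφ, hφ, hqc, one_pow, mul_one] at h

end Chart

/-! ### The function field of a resolution as a local ring of the base -/

section GenericPoint

variable {K : Type u} [Field K] {S Z : Scheme.{u}} {z : Z ⟶ Spec (.of K)} {g : S ⟶ Z}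

lemma IsResolution.nonempty_preimage (hg : IsResolution z g) (V : Z.Opens)
    (hV : (V : Set Z).Nonempty) : Nonempty (g ⁻¹ᵁ V) := by
  obtain ⟨U, hU, -, _⟩ := hg.birational
  obtain ⟨p, hpV, hpU⟩ := hU.inter_open_nonempty V V.isOpen hV
  obtain ⟨s, hs⟩ := (g ∣_ U).surjective ⟨p, hpU⟩
  refine ⟨⟨s.1, ?_⟩⟩
  have h : g s.1 = p := by
    have := congrArg Subtype.val hs
    rwa [morphismRestrict_base_coe] at this
  change g s.1 ∈ V
  rwa [h]

/-- The open set over which g is an isomorphism has dense preimage, which contains the generic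
point. -/
lemma IsResolution.isIso_stalkMap_genericPoint [IsIntegral S] (hg : IsResolution z g) :
    IsIso (g.stalkMap (genericPoint S)) := by
  obtain ⟨U, -, hU, hi⟩ := hg.birational
  have hη : genericPoint S ∈ g ⁻¹ᵁ U :=
    ((genericPoint_spec S).mem_open_set_iff (g ⁻¹ᵁ U).isOpen).2 (by simpa using hU.nonempty)
  let x : (g ⁻¹ᵁ U).toScheme := ⟨genericPoint S, hη⟩
  have h : IsIso ((g ∣_ U).stalkMap x) := inferInstance
  exact ((MorphismProperty.isomorphisms _).arrow_mk_iso_iff (morphismRestrictStalkMap g U x)).1 h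

/-- The homomorphism from the sections over `V` to the function field of a resolution. -/
def genericSection [IsIntegral S] (g : S ⟶ Z) (V : Z.Opens) [Nonempty (g ⁻¹ᵁ V)] :
    Γ(Z, V) ⟶ S.functionField :=
  g.app V ≫ S.germToFunctionField (g ⁻¹ᵁ V)

lemma genericPoint_mem_preimage [IsIntegral S] (g : S ⟶ Z) (V : Z.Opens) [Nonempty (g ⁻¹ᵁ V)] :
    g (genericPoint S) ∈ V :=
  ((genericPoint_spec S).mem_open_set_iff (g ⁻¹ᵁ V).isOpen).2
    (by simpa using ‹Nonempty (g ⁻¹ᵁ V)›)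

lemma genericSection_eq [IsIntegral S] (g : S ⟶ Z) (V : Z.Opens) [Nonempty (g ⁻¹ᵁ V)] :
    genericSection g V =
      Z.presheaf.germ V _ (genericPoint_mem_preimage g V) ≫ g.stalkMap (genericPoint S) := by
  rw [Scheme.Hom.germ_stalkMap]
  rfl

/-- The function field is the stalk of Z at the image of the generic point, hence a localisation of
Γ(Z, V) at a prime. This lemma and the next express that without assuming Z integral. -/
lemma IsResolution.exists_eq_div [IsIntegral S] (hg : IsResolution z g) {V : Z.Opens}
    (hV : IsAffineOpen V) [Nonempty (g ⁻¹ᵁ V)] (y : S.functionField) :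
    ∃ a b, (genericSection g V).hom b ≠ 0 ∧
      y * (genericSection g V).hom b = (genericSection g V).hom a := by
  have := hg.isIso_stalkMap_genericPoint
  have hη := genericPoint_mem_preimage g V
  have e : ∀ a, (genericSection g V).hom a = (g.stalkMap (genericPoint S)).hom
      ((Z.presheaf.germ V _ hη).hom a) := fun a => congr($(genericSection_eq g V).hom a)
  let := Z.presheaf.algebra_section_stalk ⟨_, hη⟩
  have hloc := hV.isLocalization_stalk ⟨_, hη⟩
  obtain ⟨y', rfl⟩ := (ConcreteCategory.bijective_of_isIso (g.stalkMap (genericPoint S))).2 y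
  obtain ⟨⟨a, b⟩, h⟩ := IsLocalization.surj
    (hV.primeIdealOf ⟨_, hη⟩).asIdeal.primeCompl y'
  refine ⟨a, b, ?_, ?_⟩
  · rw [e]
    exact ((IsLocalization.map_units _ b).map (g.stalkMap (genericPoint S)).hom).ne_zero
  · rw [e, e]
    exact ((map_mul (g.stalkMap (genericPoint S)).hom _ _).symm.trans (congrArg _ h))

lemma IsResolution.exists_mul_eq_zero [IsIntegral S] (hg : IsResolution z g) {V : Z.Opens}
    (hV : IsAffineOpen V) [Nonempty (g ⁻¹ᵁ V)] {a : Γ(Z, V)} (ha : (genericSection g V).hom a = 0) :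
    ∃ b, (genericSection g V).hom b ≠ 0 ∧ b * a = 0 := by
  have := hg.isIso_stalkMap_genericPoint
  have hη := genericPoint_mem_preimage g V
  have e : ∀ a, (genericSection g V).hom a = (g.stalkMap (genericPoint S)).hom
      ((Z.presheaf.germ V _ hη).hom a) := fun a => congr($(genericSection_eq g V).hom a)
  let := Z.presheaf.algebra_section_stalk ⟨_, hη⟩
  have hloc := hV.isLocalization_stalk ⟨_, hη⟩
  rw [e] at ha
  have ha' : (Z.presheaf.germ V _ hη).hom a = 0 :=
    (ConcreteCategory.bijective_of_isIso (g.stalkMap (genericPoint S))).1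
      (ha.trans (map_zero _).symm)
  obtain ⟨b, hb⟩ := (IsLocalization.map_eq_zero_iff
    (hV.primeIdealOf ⟨_, hη⟩).asIdeal.primeCompl (Z.presheaf.stalk (g (genericPoint S))) a).1 ha'
  refine ⟨b, ?_, hb⟩
  rw [e]
  exact ((IsLocalization.map_units _ b).map (g.stalkMap (genericPoint S)).hom).ne_zero

/-- Describes the generic point through an affine chart, so that constants can be compared there. -/
lemma fromSpecStalk_comp_eq [IsIntegral S] (g : S ⟶ Z) {V : Z.Opens} (hV : IsAffineOpen V)
    [Nonempty (g ⁻¹ᵁ V)] :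
    S.fromSpecStalk (genericPoint S) ≫ g =
      Spec.map (genericSection g V) ≫ hV.fromSpec := by
  rw [genericSection_eq, Spec.map_comp, Category.assoc, ← Scheme.SpecMap_stalkMap_fromSpecStalk,
    ← hV.fromSpecStalk_eq_fromSpecStalk (genericPoint_mem_preimage g V)]
  rfl

end GenericPoint

lemma fromSpec_basicOpen {A σ : Type*} [CommRing A] [SetLike σ A] [AddSubgroupClass σ A]
    (𝒜 : ℕ → σ) [GradedRing 𝒜] {f : A} {m : ℕ} (f_deg : f ∈ 𝒜 m) (hm : 0 < m) :
    (Proj.isAffineOpen_basicOpen 𝒜 f f_deg hm).fromSpec =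
      Spec.map (Proj.awayToSection 𝒜 f) ≫ Proj.awayι 𝒜 f f_deg hm := by
  rw [← cancel_epi (Proj.isAffineOpen_basicOpen 𝒜 f f_deg hm).isoSpec.hom,
    IsAffineOpen.isoSpec_hom_fromSpec, IsAffineOpen.isoSpec_hom, ← Category.assoc]
  change _ = Proj.basicOpenToSpec 𝒜 f ≫ _
  rw [← Proj.basicOpenIsoSpec_hom 𝒜 f f_deg hm, ← Proj.basicOpenIsoSpec_inv_ι,
    Iso.hom_inv_id_assoc]

/-! ### From a chart to the function field of the resolution -/

section Chart

variable {K : Type u} [Field K] {m : ℕ} {w : Fin m → ℕ}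
  {I : HomogeneousIdeal (weightedHomogeneousSubmodule K w)}
  (S : MinimalResolution (wprojToSpec I)) (c : Fin m)

/-- The chart `X_c ≠ 0` of `V₊(I)`. -/
abbrev chart (I : HomogeneousIdeal (weightedHomogeneousSubmodule K w)) (c : Fin m) :
    (wproj I).Opens :=
  Proj.basicOpen (coordGrading I) (Ideal.Quotient.mk I.toIdeal (X c))

lemma isAffineOpen_chart (hc : w c = 1) : IsAffineOpen (chart I c) :=
  Proj.isAffineOpen_basicOpen _ _ (var_mem I c) (by omega)

lemma chart_nonempty (hc : w c = 1) [Nontrivial (ChartRing I c)] :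
    (chart I c : Set (wproj I)).Nonempty := by
  have hι := Proj.opensRange_awayι (coordGrading I) _ (var_mem I c) (by omega)
  obtain ⟨p⟩ : Nonempty (PrimeSpectrum (ChartRing I c)) := inferInstance
  have hp : Proj.awayι (coordGrading I) _ (var_mem I c) (by omega) p ∈
      (Proj.awayι (coordGrading I) _ (var_mem I c) (by omega)).opensRange := ⟨p, rfl⟩
  rw [hι] at hp
  exact ⟨_, hp⟩

lemma MinimalResolution.nonempty_preimage_chart (hc : w c = 1) [Nontrivial (ChartRing I c)] :
    Nonempty (S.map ⁻¹ᵁ chart I c) :=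
  S.isResolution.nonempty_preimage _ (chart_nonempty c hc)

/-- The functions on a chart as sections of the structure sheaf. -/
def chartSection (I : HomogeneousIdeal (weightedHomogeneousSubmodule K w)) (c : Fin m) :
    CommRingCat.of (ChartRing I c) ⟶ Γ(wproj I, chart I c) :=
  Proj.awayToSection (coordGrading I) (Ideal.Quotient.mk I.toIdeal (X c))

/-- The homomorphism from a chart ring to the function field of the resolution. -/
def MinimalResolution.chartHom [Nonempty (S.map ⁻¹ᵁ chart I c)] :
    ChartRing I c →+* S.FunctionField :=
  (chartSection I c ≫ genericSection S.map (chart I c)).hom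

/-- The default value 0 in `coord` does not occur once the chart has nonempty preimage. -/
lemma MinimalResolution.coord_eq (hc : w c = 1) [h : Nonempty (S.map ⁻¹ᵁ chart I c)] (j : Fin m) :
    S.coord c hc j = S.chartHom c (affineCoord I c hc j) := by
  unfold MinimalResolution.coord
  exact dif_pos h

lemma chartSection_bijective (hc : w c = 1) : Function.Bijective (chartSection I c).hom :=
  have : IsIso (chartSection I c) :=
    (Proj.basicOpenIsoAway (coordGrading I) _ (var_mem I c) (by omega)).isIso_hom
  ConcreteCategory.bijective_of_isIso _

lemma MinimalResolution.generic_comp_map (hc : w c = 1) [Nonempty (S.map ⁻¹ᵁ chart I c)] :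
    S.generic ≫ S.map = Spec.map (CommRingCat.ofHom (S.chartHom c)) ≫
      Proj.awayι (coordGrading I) _ (var_mem I c) (by omega) := by
  rw [MinimalResolution.generic, fromSpecStalk_comp_eq S.map (isAffineOpen_chart c hc)]
  have : CommRingCat.ofHom (S.chartHom c) = chartSection I c ≫
      genericSection S.map (chart I c) := rfl
  rw [this, Spec.map_comp, Category.assoc]
  exact congrArg _ (fromSpec_basicOpen _ _ _)

/-- The constants of the function field are defined by the structure morphism, those of the chart
ring by the degree-zero part; both give the same morphism from the generic point to Spec K. -/
lemma MinimalResolution.chartHom_algebraMap (hc : w c = 1) [Nonempty (S.map ⁻¹ᵁ chart I c)]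
    (r : K) :
    S.chartHom c (algebraMap K (ChartRing I c) r) = algebraMap K S.FunctionField r := by
  have h : S.generic ≫ S.toSpec = Spec.map (CommRingCat.ofHom
      ((S.chartHom c).comp (algebraMap K (ChartRing I c)))) := by
    rw [MinimalResolution.toSpec, ← Category.assoc, S.generic_comp_map c hc]
    change (_ ≫ _) ≫ Proj.toSpecZero (coordGrading I) ≫ _ = _
    rw [Category.assoc, Proj.awayι_toSpecZero_assoc, ← Spec.map_comp, ← Spec.map_comp]
    rfl
  have e : Spec.preimage (S.generic ≫ S.toSpec) = CommRingCat.ofHom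
      ((S.chartHom c).comp (algebraMap K (ChartRing I c))) := by
    rw [h, Spec.preimage_map]
  exact congr($(e.symm).hom r)

end Chart

/-! ### Coordinate rings and function fields of double planes -/

section DoublePlaneField

variable {K : Type u} [Field K] (f : MvPolynomial (Fin 2) K)

/-- `A` is the coordinate ring of the double plane `y² = f(x₀, x₁)`, with coordinates `a`. -/
structure IsDoublePlaneRing (A : Type u) [CommRing A] [Algebra K A] (a : Fin 3 → A) : Prop where
  mem : OnDoublePlane f a
  gen : Algebra.adjoin K (Set.range a) = ⊤
  lift : ∀ (L : Type u) [Field L] [Algebra K L] (p : Fin 3 → L), OnDoublePlane f p →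
    ∃ ψ : A →ₐ[K] L, ∀ i, ψ (a i) = p i

/-- `F` is the function field of the double plane `y² = f(x₀, x₁)`, with coordinates `p`. -/
structure IsDoublePlaneField (F : Type u) [Field F] [Algebra K F] (p : Fin 3 → F) : Prop where
  mem : OnDoublePlane f p
  gen : IntermediateField.adjoin K (Set.range p) = ⊤
  indep : AlgebraicIndependent K ![p 0, p 1]
  lift : ∀ (L : Type u) [Field L] [Algebra K L] (q : Fin 3 → L), OnDoublePlane f q →
    AlgebraicIndependent K ![q 0, q 1] → ∃ φ : F →ₐ[K] L, ∀ i, φ (p i) = q i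

variable {f}

lemma IsDoublePlaneRing.exists_injective {A : Type u} [CommRing A] [Algebra K A] {a : Fin 3 → A}
    (ha : IsDoublePlaneRing f A a) {i : Fin 2} (hf : Odd (degreeOf i f)) :
    ∃ (L : Type u) (_ : Field L) (_ : Algebra K L) (ψ : A →ₐ[K] L), Function.Injective ψ ∧
      AlgebraicIndependent K ![ψ (a 0), ψ (a 1)] := by
  obtain ⟨L, _, _, p, hp, hind⟩ := exists_generic_onDoublePlane f
  obtain ⟨ψ, hψ⟩ := ha.lift L p hp
  have hind' : AlgebraicIndependent K ![ψ (a 0), ψ (a 1)] := by rwa [hψ, hψ]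
  exact ⟨L, _, _, ψ, ha.mem.injective ha.gen hf ψ hind', hind'⟩

/-- The field of fractions of the coordinate ring of an irreducible double plane. -/
lemma IsDoublePlaneRing.isDoublePlaneField {A : Type u} [CommRing A] [Algebra K A] {a : Fin 3 → A}
    (ha : IsDoublePlaneRing f A a) {i : Fin 2} (hf : Odd (degreeOf i f))
    {F : Type u} [Field F] [Algebra K F] (θ : A →ₐ[K] F) (hθ : Function.Injective θ)
    (hsurj : ∀ y : F, ∃ b c, θ c ≠ 0 ∧ y * θ c = θ b) : IsDoublePlaneField f F (θ ∘ a) := by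
  -- That A is a domain is not assumed: it embeds in the field of a generic point of the double
  -- plane.
  obtain ⟨L₀, _, _, ψ₀, hψ₀, hind⟩ := ha.exists_injective hf
  have hdom : IsDomain A := hψ₀.isDomain ψ₀.toRingHom
  have hA : AlgebraicIndependent K ![a 0, a 1] := by
    intro p q hpq
    apply hind
    rw [← map_aeval_pair, ← map_aeval_pair]
    exact congrArg ψ₀ hpq
  let : Algebra A F := θ.toRingHom.toAlgebra
  have hst : IsScalarTower K A F := IsScalarTower.of_algebraMap_eq fun k => (θ.commutes k).symm
  have hfaith : FaithfulSMul A F := (faithfulSMul_iff_algebraMap_injective A F).2 hθ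
  have hfrac : IsFractionRing A F := IsFractionRing.of_field A F fun y => by
    obtain ⟨b, c, hc, h⟩ := hsurj y
    exact ⟨b, c, (eq_div_of_mul_eq hc h)⟩
  refine ⟨ha.mem.map θ, ?_, ?_, ?_⟩
  · rw [eq_top_iff]
    rintro y -
    have hmem : ∀ b, θ b ∈ IntermediateField.adjoin K (Set.range (θ ∘ a)) := by
      intro b
      have hb : b ∈ Algebra.adjoin K (Set.range a) := ha.gen ▸ Algebra.mem_top
      have : θ b ∈ (Algebra.adjoin K (Set.range a)).map θ := ⟨b, hb, rfl⟩
      rw [AlgHom.map_adjoin, ← Set.range_comp] at this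
      exact IntermediateField.algebra_adjoin_le_adjoin _ _ this
    obtain ⟨b, c, hc, h⟩ := hsurj y
    rw [eq_div_of_mul_eq hc h]
    exact div_mem (hmem b) (hmem c)
  · intro p q hpq
    apply hA
    apply hθ
    rw [map_aeval_pair, map_aeval_pair]
    exact hpq
  · intro L _ _ q hq hq'
    obtain ⟨ψ, hψ⟩ := ha.lift L q hq
    have hinj : Function.Injective ψ := ha.mem.injective ha.gen hf ψ (by rwa [hψ, hψ])
    refine ⟨IsFractionRing.liftAlgHom (K := F) (g := ψ) hinj, fun j => ?_⟩
    rw [← hψ]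
    exact IsFractionRing.lift_algebraMap (K := F) hinj (a j)

end DoublePlaneField

/-! ### The function field of a resolved double plane -/

section Resolution

variable {K : Type u} [Field K] {m : ℕ} {w : Fin m → ℕ}
  {I : HomogeneousIdeal (weightedHomogeneousSubmodule K w)}
  (S : MinimalResolution (wprojToSpec I)) (c : Fin m)

lemma MinimalResolution.isDoublePlaneField (hc : w c = 1) {f : MvPolynomial (Fin 2) K}
    {e : Fin 3 → Fin m}
    (ha : IsDoublePlaneRing f (ChartRing I c) (affineCoord I c hc ∘ e)) {i : Fin 2}
    (hf : Odd (degreeOf i f)) :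
    IsDoublePlaneField f S.FunctionField (S.coord c hc ∘ e) := by
  obtain ⟨L₀, _, _, ψ₀, hψ₀, -⟩ := ha.exists_injective hf
  have hdom : IsDomain (ChartRing I c) := hψ₀.isDomain ψ₀.toRingHom
  have hne := S.nonempty_preimage_chart c hc
  let θ : ChartRing I c →ₐ[K] S.FunctionField :=
    { S.chartHom c with commutes' := S.chartHom_algebraMap c hc }
  have hbij := chartSection_bijective (I := I) c hc
  have hθ : ∀ b, θ b = (genericSection S.map (chart I c)).hom ((chartSection I c).hom b) :=
    fun _ => rfl
  have e : S.coord c hc ∘ e = θ ∘ affineCoord I c hc ∘ e := by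
    ext j
    exact S.coord_eq c hc (e j)
  rw [e]
  refine ha.isDoublePlaneField hf θ ?_ ?_
  · rw [injective_iff_map_eq_zero]
    intro b hb
    rw [hθ] at hb
    -- An element of the kernel is killed by some d with nonzero image, and the chart ring is a
    -- domain.
    obtain ⟨d, hd, hdb⟩ := S.isResolution.exists_mul_eq_zero (isAffineOpen_chart c hc) hb
    obtain ⟨d, rfl⟩ := hbij.2 d
    rw [← map_mul] at hdb
    have h0 := hbij.1 (hdb.trans (map_zero _).symm)
    rcases mul_eq_zero.1 h0 with rfl | h
    · exact absurd (by rw [map_zero, map_zero]) hd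
    · exact h
  · intro y
    obtain ⟨b, d, hd, h⟩ := S.isResolution.exists_eq_div (isAffineOpen_chart c hc) y
    obtain ⟨b, rfl⟩ := hbij.2 b
    obtain ⟨d, rfl⟩ := hbij.2 d
    exact ⟨b, d, hd, h⟩

end Resolution

/-! ### Dominant rational maps from homomorphisms of function fields -/

section DominantMaps

variable {K : Type u} [Field K] {Z Z' : Scheme.{u}} {z : Z ⟶ Spec (.of K)} {z' : Z' ⟶ Spec (.of K)}

lemma MinimalResolution.generic_toSpec (S : MinimalResolution z) :
    S.generic ≫ S.toSpec = Spec.map (CommRingCat.ofHom (algebraMap K S.FunctionField)) :=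
  (Spec.map_preimage _).symm

lemma MinimalResolution.generic_apply (S : MinimalResolution z) (p : Spec (.of S.FunctionField)) :
    S.generic p = genericPoint S.surface := by
  have h : p = IsLocalRing.closedPoint S.FunctionField :=
    Subsingleton.elim (α := PrimeSpectrum S.FunctionField) _ _
  rw [h]
  exact Scheme.fromSpecStalk_closedPoint

/-- An image that contains the generic point is dense. -/
lemma isDominant_of_fromFunctionField {X Y : Scheme.{u}} [IrreducibleSpace X] [IrreducibleSpace Y]
    (r : X ⤏ Y) (h : ∃ p, r.fromFunctionField p = genericPoint Y) : r.IsDominant := by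
  obtain ⟨r, rfl⟩ := r.exists_rep
  rw [Scheme.PartialMap.isDominant_toRationalMap_iff]
  obtain ⟨p, hp⟩ := h
  refine ⟨?_⟩
  have hmem : genericPoint Y ∈ Set.range r.hom := by
    rw [← hp]
    exact ⟨_, (Scheme.Hom.comp_apply _ _ _).symm⟩
  exact (dense_iff_closure_eq.2 (genericPoint_closure Y)).mono (Set.singleton_subset_iff.2 hmem)

/-- A homomorphism of function fields is induced by a dominant rational map. -/
lemma exists_dominantMap (S : MinimalResolution z) (T : MinimalResolution z')
    (φ : T.FunctionField →ₐ[K] S.FunctionField) : ∃ r : DominantMap S T, r.comap = φ := by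
  have hft : LocallyOfFiniteType T.toSpec := by
    have := T.isResolution.smooth
    change LocallyOfFiniteType (T.map ≫ z')
    infer_instance
  have h : (Spec.map (CommRingCat.ofHom φ.toRingHom) ≫ T.generic) ≫ T.toSpec =
      S.surface.fromSpecStalk _ ≫ S.toSpec := by
    rw [Category.assoc, T.generic_toSpec, ← Spec.map_comp]
    refine Eq.trans ?_ S.generic_toSpec.symm
    congr 1
    ext k
    exact φ.commutes k
  let r := Scheme.RationalMap.equivFunctionField S.toSpec T.toSpec
    ⟨Spec.map (CommRingCat.ofHom φ.toRingHom) ≫ T.generic, h⟩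
  have hr : r.1.fromFunctionField = Spec.map (CommRingCat.ofHom φ.toRingHom) ≫ T.generic :=
    Scheme.RationalMap.fromFunctionField_ofFunctionField S.toSpec T.toSpec _ h
  refine ⟨⟨r.1, r.2, ?_, φ, hr.symm⟩, rfl⟩
  apply isDominant_of_fromFunctionField
  rw [hr]
  let p : PrimeSpectrum S.FunctionField := IsLocalRing.closedPoint S.FunctionField
  exact ⟨p, (Scheme.Hom.comp_apply _ _ _).trans (T.generic_apply _)⟩

end DominantMaps

/-! ### The two models as double planes -/

section Models

variable {K : Type u} [Field K]

/-- The affine branch polynomial of the double quadric. -/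
def kumPoly (E₁ E₂ : WeierstrassCurve K) (ε : K) : MvPolynomial (Fin 2) K :=
  C ε * (X 0 * (X 0 ^ 2 + C E₁.a₂ * X 0 + C E₁.a₄) * (X 1 * (X 1 ^ 2 + C E₂.a₂ * X 1 + C E₂.a₄)))

/-- The affine branch polynomial of the twisted Legendre pencil. -/
def pencilPoly (ρ₁ ρ₂ : K) : MvPolynomial (Fin 2) K :=
  X 0 * (X 0 - 1) * (X 0 - X 1) * (X 1 ^ 2 + C (2 * ρ₁) * X 1 + C (ρ₂ ^ 2))

lemma quadratic_ne_zero (a b : K) :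
    (X 0 ^ 2 + C a * X 0 + C b : MvPolynomial (Fin 1) K) ≠ 0 := by
  intro h
  have h' := congrArg (aeval fun _ => (Polynomial.X : Polynomial K)) h
  simp only [map_add, map_mul, map_pow, aeval_X, map_zero, algHom_C,
    Polynomial.algebraMap_eq] at h'
  have h2 := congrArg (fun p => Polynomial.coeff p 2) h'
  simp at h2

/-- Over K[x₁] the polynomial is a monic cubic in x₀ times a nonzero element of K[x₁], so the degree
is 3. The same holds for the pencil. -/
lemma kumPoly_degreeOf (E₁ E₂ : WeierstrassCurve K) {ε : K} (hε : ε ≠ 0) :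
    Odd (degreeOf 0 (kumPoly E₁ E₂ ε)) := by
  rw [← natDegree_finSuccEquiv]
  have e : finSuccEquiv K 1 (kumPoly E₁ E₂ ε) = Polynomial.X *
      (Polynomial.C 1 * Polynomial.X ^ 2 + Polynomial.C (C E₁.a₂) * Polynomial.X +
        Polynomial.C (C E₁.a₄)) *
      Polynomial.C (C ε * (X 0 * (X 0 ^ 2 + C E₂.a₂ * X 0 + C E₂.a₄))) := by
    have h1 : finSuccEquiv K 1 (X 1) = Polynomial.C (X 0) := finSuccEquiv_X_succ (j := 0)
    have hC : ∀ r : K, finSuccEquiv K 1 (C r) = Polynomial.C (C r) := fun r => by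
      simp [finSuccEquiv_apply]
    simp only [kumPoly, map_mul, map_add, map_pow, finSuccEquiv_X_zero, h1, hC, map_one]
    ring
  have hC0 : C ε * (X 0 * (X 0 ^ 2 + C E₂.a₂ * X 0 + C E₂.a₄)) ≠ (0 : MvPolynomial (Fin 1) K) :=
    mul_ne_zero (by simpa using hε) (mul_ne_zero (X_ne_zero 0) (quadratic_ne_zero _ _))
  have hq := Polynomial.natDegree_quadratic (R := MvPolynomial (Fin 1) K) (a := 1)
    (b := C E₁.a₂) (c := C E₁.a₄) one_ne_zero
  have hq0 : Polynomial.C 1 * Polynomial.X ^ 2 + Polynomial.C (C E₁.a₂) * Polynomial.X +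
        Polynomial.C (C E₁.a₄) ≠ (0 : Polynomial (MvPolynomial (Fin 1) K)) :=
    Polynomial.ne_zero_of_natDegree_gt (n := 1) (by omega)
  rw [e, Polynomial.natDegree_mul_C hC0, Polynomial.natDegree_mul Polynomial.X_ne_zero hq0, hq,
    Polynomial.natDegree_X]
  decide

lemma pencilPoly_degreeOf (ρ₁ ρ₂ : K) : Odd (degreeOf 0 (pencilPoly ρ₁ ρ₂)) := by
  rw [← natDegree_finSuccEquiv]
  have e : finSuccEquiv K 1 (pencilPoly ρ₁ ρ₂) = Polynomial.X *
      (Polynomial.X - Polynomial.C 1) * (Polynomial.X - Polynomial.C (X 0)) *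
      Polynomial.C (X 0 ^ 2 + C (2 * ρ₁) * X 0 + C (ρ₂ ^ 2)) := by
    have h1 : finSuccEquiv K 1 (X 1) = Polynomial.C (X 0) := finSuccEquiv_X_succ (j := 0)
    have hC : ∀ r : K, finSuccEquiv K 1 (C r) = Polynomial.C (C r) := fun r => by
      simp [finSuccEquiv_apply]
    simp only [pencilPoly, map_mul, map_add, map_sub, map_pow, finSuccEquiv_X_zero, h1, hC,
      map_one]
  rw [e, Polynomial.natDegree_mul_C (quadratic_ne_zero _ _),
    Polynomial.natDegree_mul (mul_ne_zero Polynomial.X_ne_zero (Polynomial.X_sub_C_ne_zero _))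
      (Polynomial.X_sub_C_ne_zero _),
    Polynomial.natDegree_mul Polynomial.X_ne_zero (Polynomial.X_sub_C_ne_zero _),
    Polynomial.natDegree_X, Polynomial.natDegree_X_sub_C, Polynomial.natDegree_X_sub_C]
  decide

lemma onDoublePlane_kumPoly {E₁ E₂ : WeierstrassCurve K} {ε : K} {A : Type*} [CommRing A]
    [Algebra K A] {p : Fin 3 → A} : OnDoublePlane (kumPoly E₁ E₂ ε) p ↔
      p 2 ^ 2 = algebraMap K A ε *
        (p 0 * (p 0 ^ 2 + algebraMap K A E₁.a₂ * p 0 + algebraMap K A E₁.a₄) *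
          (p 1 * (p 1 ^ 2 + algebraMap K A E₂.a₂ * p 1 + algebraMap K A E₂.a₄))) := by
  simp [OnDoublePlane, kumPoly]

lemma onDoublePlane_pencilPoly {ρ₁ ρ₂ : K} {A : Type*} [CommRing A] [Algebra K A]
    {p : Fin 3 → A} : OnDoublePlane (pencilPoly ρ₁ ρ₂) p ↔
      p 2 ^ 2 = p 0 * (p 0 - 1) * (p 0 - p 1) *
        (p 1 ^ 2 + 2 * algebraMap K A ρ₁ * p 1 + algebraMap K A ρ₂ ^ 2) := by
  simp [OnDoublePlane, pencilPoly, map_ofNat]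

lemma isDoublePlaneRing_kum (E₁ E₂ : WeierstrassCurve K) (ε : K) :
    IsDoublePlaneRing (kumPoly E₁ E₂ ε) (ChartRing (doubleQuadricIdeal E₁ E₂ ε) 3)
      (affineCoord (doubleQuadricIdeal E₁ E₂ ε) 3 rfl ∘ ![1, 2, 4]) := by
  set I := doubleQuadricIdeal E₁ E₂ ε with hI
  have h3 : affineCoord I 3 rfl 3 = 1 := ChartRing.affineCoord_self I 3 rfl
  -- The Segre relation makes X₀ redundant on the chart X₃ ≠ 0, which leaves x₁, x₂ and y.
  have hq : affineCoord I 3 rfl 0 = affineCoord I 3 rfl 1 * affineCoord I 3 rfl 2 := by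
    have h : IsWeightedHomogeneous quadricWeight (X 0 * X 3 - X 1 * X 2 : MvPolynomial (Fin 5) K)
        2 :=
      isWeightedHomogeneous_sub
        ((isWeightedHomogeneous_X K quadricWeight 0).mul
          (isWeightedHomogeneous_X K quadricWeight 3))
        ((isWeightedHomogeneous_X K quadricWeight 1).mul
          (isWeightedHomogeneous_X K quadricWeight 2))
    have h0 := ChartRing.aeval_eq_zero I 3 rfl h (Ideal.subset_span (by simp))
    simp only [map_sub, map_mul, aeval_X, h3, mul_one] at h0
    exact sub_eq_zero.1 h0
  refine ⟨?_, ?_, ?_⟩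
  · have h : IsWeightedHomogeneous quadricWeight (X 4 ^ 2 - C ε * branchForm E₁ E₂) 4 :=
      isWeightedHomogeneous_sub ((isWeightedHomogeneous_X K quadricWeight 4).pow 2)
        (isWeightedHomogeneous_C_mul _ (branchForm_homogeneous E₁ E₂))
    have h0 := ChartRing.aeval_eq_zero I 3 rfl h (Ideal.subset_span (by simp))
    rw [onDoublePlane_kumPoly]
    simp only [branchForm, map_sub, map_mul, map_add, map_pow, aeval_X, algHom_C, h3, hq] at h0
    simp only [Function.comp_apply, Matrix.cons_val]
    linear_combination h0
  · rw [← top_le_iff, ← ChartRing.adjoin_affineCoord I 3 rfl, Algebra.adjoin_le_iff]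
    rintro _ ⟨j, rfl⟩
    have hmem : ∀ j : Fin 3, affineCoord I 3 rfl (![1, 2, 4] j) ∈
        Algebra.adjoin K (Set.range (affineCoord I 3 rfl ∘ ![1, 2, 4])) := fun j =>
      Algebra.subset_adjoin ⟨j, rfl⟩
    fin_cases j
    · change affineCoord I 3 rfl 0 ∈ _
      rw [hq]
      exact mul_mem (hmem 0) (hmem 1)
    · exact hmem 0
    · exact hmem 1
    · change affineCoord I 3 rfl 3 ∈ _
      rw [h3]
      exact one_mem _
    · exact hmem 2
  · intro L _ _ p hp
    rw [onDoublePlane_kumPoly] at hp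
    obtain ⟨ψ, hψ⟩ := ChartRing.exists_algHom I 3 rfl ![p 0 * p 1, p 0, p 1, 1, p 2] (by
      intro q hq
      have hle : I.toIdeal ≤ RingHom.ker (aeval (R := K) ![p 0 * p 1, p 0, p 1, 1, p 2]) := by
        refine Ideal.span_le.2 ?_
        rintro q (rfl | rfl)
        · simp [RingHom.mem_ker]
        · simp only [SetLike.mem_coe, RingHom.mem_ker, branchForm, map_sub, map_mul, map_add,
            map_pow, aeval_X, algHom_C, Matrix.cons_val]
          linear_combination hp
      exact hle hq) rfl
    refine ⟨ψ, fun j => ?_⟩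
    rw [Function.comp_apply, hψ]
    fin_cases j <;> rfl

lemma isDoublePlaneRing_pencil (ρ₁ ρ₂ : K) :
    IsDoublePlaneRing (pencilPoly ρ₁ ρ₂) (ChartRing (legendrePencilIdeal ρ₁ ρ₂) 1)
      (affineCoord (legendrePencilIdeal ρ₁ ρ₂) 1 rfl ∘ ![0, 2, 3]) := by
  set I := legendrePencilIdeal ρ₁ ρ₂ with hI
  have h1 : affineCoord I 1 rfl 1 = 1 := ChartRing.affineCoord_self I 1 rfl
  refine ⟨?_, ?_, ?_⟩
  · have h : ∀ i : Fin 4, IsWeightedHomogeneous sexticWeight (X i : MvPolynomial (Fin 4) K)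
      (sexticWeight i) := isWeightedHomogeneous_X K _
    have h6 : IsWeightedHomogeneous sexticWeight (X 3 ^ 2 - X 0 * X 1 * (X 0 - X 1) * (X 0 - X 2) *
      (X 2 ^ 2 + C (2 * ρ₁) * (X 1 * X 2) + C (ρ₂ ^ 2) * X 1 ^ 2)) 6 := by
      refine isWeightedHomogeneous_sub ((h 3).pow 2) ?_
      refine ((((h 0).mul (h 1)).mul (isWeightedHomogeneous_sub (h 0) (h 1))).mul
        (isWeightedHomogeneous_sub (h 0) (h 2))).mul (n := 2) ?_
      exact (((h 2).pow 2).add (isWeightedHomogeneous_C_mul _ ((h 1).mul (h 2)))).add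
        (isWeightedHomogeneous_C_mul _ ((h 1).pow 2))
    have h0 := ChartRing.aeval_eq_zero I 1 rfl h6 (Ideal.subset_span (by simp))
    rw [onDoublePlane_pencilPoly]
    simp only [map_sub, map_mul, map_add, map_pow, aeval_X, algHom_C, h1, map_ofNat] at h0
    simp only [Function.comp_apply, Matrix.cons_val]
    linear_combination h0
  · rw [← top_le_iff, ← ChartRing.adjoin_affineCoord I 1 rfl, Algebra.adjoin_le_iff]
    rintro _ ⟨j, rfl⟩
    have hmem : ∀ j : Fin 3, affineCoord I 1 rfl (![0, 2, 3] j) ∈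
        Algebra.adjoin K (Set.range (affineCoord I 1 rfl ∘ ![0, 2, 3])) := fun j =>
      Algebra.subset_adjoin ⟨j, rfl⟩
    fin_cases j
    · exact hmem 0
    · change affineCoord I 1 rfl 1 ∈ _
      rw [h1]
      exact one_mem _
    · exact hmem 1
    · exact hmem 2
  · intro L _ _ p hp
    rw [onDoublePlane_pencilPoly] at hp
    obtain ⟨ψ, hψ⟩ := ChartRing.exists_algHom I 1 rfl ![p 0, 1, p 1, p 2] (by
      intro q hq
      have hle : I.toIdeal ≤ RingHom.ker (aeval (R := K) ![p 0, 1, p 1, p 2]) := by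
        refine Ideal.span_le.2 ?_
        rintro q rfl
        simp only [SetLike.mem_coe, RingHom.mem_ker, map_sub, map_mul, map_add,
          map_pow, aeval_X, algHom_C, Matrix.cons_val, map_ofNat]
        linear_combination hp
      exact hle hq) rfl
    refine ⟨ψ, fun j => ?_⟩
    rw [Function.comp_apply, hψ]
    fin_cases j <;> rfl

lemma comp_fin_three {α β : Type*} (f : α → β) (a b c : α) :
    f ∘ ![a, b, c] = ![f a, f b, f c] := by
  ext i
  fin_cases i <;> rfl

/-- The function field of a Kummer surface is that of the affine double plane. -/
lemma Kum.isDoublePlaneField {E₁ E₂ : WeierstrassCurve K} {ε : K} (hε : ε ≠ 0) (S : Kum E₁ E₂ ε) :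
    IsDoublePlaneField (kumPoly E₁ E₂ ε) S.FunctionField (Kum.coords S) := by
  have h := MinimalResolution.isDoublePlaneField S 3 rfl (isDoublePlaneRing_kum E₁ E₂ ε)
    (kumPoly_degreeOf E₁ E₂ hε)
  rwa [comp_fin_three] at h

/-- The function field of the twisted Legendre pencil is that of the affine double plane. -/
lemma LegendreK3.isDoublePlaneField {ρ₁ ρ₂ : K} (S : LegendreK3 ρ₁ ρ₂) :
    IsDoublePlaneField (pencilPoly ρ₁ ρ₂) S.FunctionField (LegendreK3.coords S) := by
  have h := MinimalResolution.isDoublePlaneField S 1 rfl (isDoublePlaneRing_pencil ρ₁ ρ₂)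
    (pencilPoly_degreeOf ρ₁ ρ₂)
  rwa [comp_fin_three] at h

end Models

/-! ### Calculus of rational two-forms -/

section Forms

variable {K F : Type u} [Field K] [Field F] [Algebra K F]

/-- The two-form `dx ∧ dy`. -/
def wedge (K : Type u) {F : Type u} [Field K] [Field F] [Algebra K F] (x y : F) : TwoForm K F :=
  exteriorPower.ιMulti F 2 ![KaehlerDifferential.D K F x, KaehlerDifferential.D K F y]

/-- The determinant of the basis is an alternating form that takes the value 1 on this pair. -/
lemma wedge_ne_zero_of_basis {x : Fin 2 → F} (b : Module.Basis (Fin 2) F Ω[F⁄K])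
    (hb : ∀ i, b i = KaehlerDifferential.D K F (x i)) : wedge K (x 0) (x 1) ≠ 0 := by
  intro h
  have h1 := congrArg (exteriorPower.alternatingMapLinearEquiv b.det) h
  have e : ![KaehlerDifferential.D K F (x 0), KaehlerDifferential.D K F (x 1)] = b := by
    ext i
    fin_cases i
    · exact (hb 0).symm
    · exact (hb 1).symm
  rw [wedge, exteriorPower.alternatingMapLinearEquiv_apply_ιMulti, e, map_zero,
    Module.Basis.det_self] at h1
  exact one_ne_zero h1

/-- The function field of a double plane is formally étale over the coordinate ring of the plane, so
that `dx₀ ∧ dx₁ ≠ 0`. -/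
lemma IsDoublePlaneField.wedge_ne_zero [CharZero K] {f : MvPolynomial (Fin 2) K} {p : Fin 3 → F}
    (hF : IsDoublePlaneField f F p) : wedge K (p 0) (p 1) ≠ 0 := by
  let R := MvPolynomial (Fin 2) K
  let : Algebra R F := (aeval ![p 0, p 1]).toRingHom.toAlgebra
  have hmap : ∀ r : R, algebraMap R F r = aeval ![p 0, p 1] r := fun _ => rfl
  have hst : IsScalarTower K R F := IsScalarTower.of_algebraMap_eq fun k => by
    rw [hmap, algebraMap_eq, aeval_C]
  have hfaith : FaithfulSMul R F := (faithfulSMul_iff_algebraMap_injective R F).2 hF.indep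
  let : Algebra (FractionRing R) F := FractionRing.liftAlgebra R F
  have hst' : IsScalarTower R (FractionRing R) F := FractionRing.isScalarTower_liftAlgebra R F
  have hst'' : IsScalarTower K (FractionRing R) F := IsScalarTower.of_algebraMap_eq fun k => by
    rw [IsScalarTower.algebraMap_apply K R F, IsScalarTower.algebraMap_apply R (FractionRing R) F,
      ← IsScalarTower.algebraMap_apply K R (FractionRing R)]
  have hchar : CharZero (FractionRing R) :=
    charZero_of_injective_algebraMap (algebraMap K (FractionRing R)).injective
  have halgmem : ∀ r : R, IsAlgebraic (FractionRing R) (algebraMap R F r) := fun r => by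
    rw [IsScalarTower.algebraMap_apply R (FractionRing R) F]
    exact isAlgebraic_algebraMap _
  have hle : IntermediateField.adjoin K (Set.range p) ≤
      (algebraicClosure (FractionRing R) F).restrictScalars K := by
    rw [IntermediateField.adjoin_le_iff]
    rintro _ ⟨i, rfl⟩
    rw [IntermediateField.coe_restrictScalars, SetLike.mem_coe, mem_algebraicClosure_iff]
    fin_cases i
    · simpa [hmap] using halgmem (X 0)
    · simpa [hmap] using halgmem (X 1)
    · refine IsAlgebraic.of_pow two_pos ?_
      have h := hF.mem
      rw [OnDoublePlane, ← hmap] at h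
      exact h ▸ halgmem f
  have halg : Algebra.IsAlgebraic (FractionRing R) F := ⟨fun y => by
    have hy : y ∈ (algebraicClosure (FractionRing R) F).restrictScalars K :=
      hle (hF.gen ▸ IntermediateField.mem_top)
    exact mem_algebraicClosure_iff.1 hy⟩
  -- A localisation followed by an algebraic extension, separable in characteristic zero. Hence dx₀,
  -- dx₁ remain a basis of the differentials.
  have h1 : Algebra.FormallyEtale R (FractionRing R) :=
    Algebra.FormallyEtale.of_isLocalization (nonZeroDivisors R)
  have h2 : Algebra.FormallyEtale (FractionRing R) F := Algebra.FormallyEtale.of_isSeparable _ _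
  have h3 : Algebra.FormallyEtale R F := Algebra.FormallyEtale.comp R (FractionRing R) F
  refine wedge_ne_zero_of_basis (x := ![p 0, p 1])
    (((KaehlerDifferential.mvPolynomialBasis K (Fin 2)).baseChange F).map
      (KaehlerDifferential.tensorKaehlerEquivOfFormallyEtale K R F)) fun i => ?_
  rw [Module.Basis.map_apply, Module.Basis.baseChange_apply,
    KaehlerDifferential.tensorKaehlerEquivOfFormallyEtale_apply,
    KaehlerDifferential.mapBaseChange_tmul, one_smul,
    KaehlerDifferential.mvPolynomialBasis_apply, KaehlerDifferential.map_D, hmap, aeval_X]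

/-- `du = a dx + b dt`. -/
def HasPartials (K : Type u) {F : Type u} [Field K] [Field F] [Algebra K F] (x t u a b : F) :
    Prop :=
  KaehlerDifferential.D K F u = a • KaehlerDifferential.D K F x + b • KaehlerDifferential.D K F t

variable {x t u v a b c d : F}

lemma HasPartials.fst (x t : F) : HasPartials K x t x 1 0 := by
  simp [HasPartials]

lemma HasPartials.snd (x t : F) : HasPartials K x t t 0 1 := by
  simp [HasPartials]

lemma HasPartials.const (x t : F) (k : K) : HasPartials K x t (algebraMap K F k) 0 0 := by
  simp [HasPartials]

lemma HasPartials.natCast (x t : F) (n : ℕ) : HasPartials K x t (n : F) 0 0 := by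
  simpa using HasPartials.const x t (n : K)

lemma HasPartials.add (hu : HasPartials K x t u a b) (hv : HasPartials K x t v c d) :
    HasPartials K x t (u + v) (a + c) (b + d) := by
  unfold HasPartials at *
  rw [map_add, hu, hv]
  module

lemma HasPartials.sub (hu : HasPartials K x t u a b) (hv : HasPartials K x t v c d) :
    HasPartials K x t (u - v) (a - c) (b - d) := by
  unfold HasPartials at *
  rw [map_sub, hu, hv]
  module

lemma HasPartials.mul (hu : HasPartials K x t u a b) (hv : HasPartials K x t v c d) :
    HasPartials K x t (u * v) (a * v + u * c) (b * v + u * d) := by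
  unfold HasPartials at *
  rw [Derivation.leibniz, hu, hv]
  module

lemma HasPartials.div (hu : HasPartials K x t u a b) (hv : HasPartials K x t v c d) :
    HasPartials K x t (u / v) ((a * v - u * c) / v ^ 2) ((b * v - u * d) / v ^ 2) := by
  unfold HasPartials at *
  rw [Derivation.leibniz_div, hu, hv]
  module

lemma ιMulti_pair_comm {M : Type*} [AddCommGroup M] [Module F M] (α β : M) :
    exteriorPower.ιMulti F 2 ![β, α] = -exteriorPower.ιMulti F 2 ![α, β] := by
  rw [← (exteriorPower.ιMulti F 2).map_swap ![α, β] (i := 0) (j := 1) (by decide)]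
  congr 1
  ext i
  fin_cases i <;> rfl

lemma ιMulti_pair_self {M : Type*} [AddCommGroup M] [Module F M] (α : M) :
    exteriorPower.ιMulti F 2 ![α, α] = 0 :=
  (exteriorPower.ιMulti F 2).map_eq_zero_of_eq ![α, α] (i := 0) (j := 1) rfl (by decide)

lemma ιMulti_pair_comb {M : Type*} [AddCommGroup M] [Module F M] (a b : F) (α β γ : M) :
    exteriorPower.ιMulti F 2 ![a • α + b • β, γ] =
      a • exteriorPower.ιMulti F 2 ![α, γ] + b • exteriorPower.ιMulti F 2 ![β, γ] := by
  have h1 := (exteriorPower.ιMulti F 2 (M := M)).map_vecCons_add ![γ] (a • α) (b • β)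
  have h2 := (exteriorPower.ιMulti F 2 (M := M)).map_vecCons_smul ![γ] a α
  have h3 := (exteriorPower.ιMulti F 2 (M := M)).map_vecCons_smul ![γ] b β
  rw [h1, h2, h3]

lemma wedge_eq (hu : HasPartials K x t u a b) (hv : HasPartials K x t v c d) :
    wedge K u v = (a * d - b * c) • wedge K x t := by
  unfold HasPartials at hu hv
  unfold wedge
  rw [hu, hv, ιMulti_pair_comb, ιMulti_pair_comm _ (KaehlerDifferential.D K F x),
    ιMulti_pair_comm _ (KaehlerDifferential.D K F t), ιMulti_pair_comb, ιMulti_pair_comb,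
    ιMulti_pair_self, ιMulti_pair_self,
    ιMulti_pair_comm (KaehlerDifferential.D K F x) (KaehlerDifferential.D K F t)]
  module

lemma natForm_eq (K : Type u) {F : Type u} [Field K] [Field F] [Algebra K F] (x y t : F) :
    natForm K x y t = t⁻¹ • wedge K x y := rfl

lemma exists_pderiv_ne_zero [CharZero K] {P : MvPolynomial (Fin 2) K} (hP : P.totalDegree ≠ 0) :
    ∃ i, pderiv i P ≠ 0 := by
  by_contra! h
  apply hP
  rw [totalDegree_eq_zero_iff]
  intro m hm i
  by_contra hmi
  have h0 := congrArg (coeff (m - Finsupp.single i 1)) (h i)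
  rw [coeff_pderiv, coeff_zero, tsub_add_cancel_of_le
    (Finsupp.single_le_iff.2 (Nat.one_le_iff_ne_zero.2 hmi))] at h0
  rcases mul_eq_zero.1 h0 with h1 | h1
  · exact mem_support_iff.1 hm h1
  · exact Nat.cast_add_one_ne_zero _ h1

lemma totalDegree_pderiv_lt {P : MvPolynomial (Fin 2) K} {i : Fin 2} (hP : pderiv i P ≠ 0) :
    (pderiv i P).totalDegree < P.totalDegree := by
  have key : ∀ m ∈ (pderiv i P).support, (m.sum fun _ e => e) + 1 ≤ P.totalDegree := by
    intro m hm
    rw [mem_support_iff, coeff_pderiv] at hm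
    have h := le_totalDegree (mem_support_iff.2 (left_ne_zero_of_mul hm))
    rwa [Finsupp.sum_add_index' (fun _ => rfl) (fun _ _ _ => rfl),
      Finsupp.sum_single_index rfl] at h
  obtain ⟨m, hm⟩ := support_nonempty.2 hP
  exact (Finset.sup_lt_iff (by have := key m hm; exact Nat.lt_of_lt_of_le (Nat.succ_pos _) this)).2
    fun m hm => key m hm

lemma hasPartials_aeval (x t : F) (P : MvPolynomial (Fin 2) K) :
    HasPartials K x t (aeval ![x, t] P) (aeval ![x, t] (pderiv 0 P))
      (aeval ![x, t] (pderiv 1 P)) := by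
  induction P using MvPolynomial.induction_on with
  | C k => simpa using HasPartials.const x t k
  | add P Q hP hQ => simpa using hP.add hQ
  | mul_X P i hP =>
    fin_cases i
    · have := hP.mul (HasPartials.fst x t)
      simpa [pderiv_X, add_comm, mul_comm] using this
    · have := hP.mul (HasPartials.snd x t)
      simpa [pderiv_X, add_comm, mul_comm] using this

/-- Functions with `dx ∧ dt ≠ 0` are algebraically independent. -/
lemma algebraicIndependent_of_wedge_ne_zero [CharZero K] (h : wedge K x t ≠ 0) :
    AlgebraicIndependent K ![x, t] := by
  have hinj : ∀ n, ∀ P : MvPolynomial (Fin 2) K, P.totalDegree ≤ n → aeval ![x, t] P = 0 →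
      P = 0 := by
    intro n
    induction n with
    | zero =>
      intro P hP h0
      rw [totalDegree_eq_zero_iff_eq_C.1 (Nat.le_zero.1 hP)] at h0 ⊢
      rw [aeval_C, map_eq_zero] at h0
      rw [h0, C_0]
    | succ n ih =>
      intro P hP h0
      by_cases hd : P.totalDegree = 0
      · rw [totalDegree_eq_zero_iff_eq_C.1 hd] at h0 ⊢
        rw [aeval_C, map_eq_zero] at h0
        rw [h0, C_0]
      · exfalso
        -- Differentiating P(x, t) = 0 and wedging with dt and dx shows that both partial
        -- derivatives vanish at (x, t). One of them is a nonzero polynomial of smaller degree,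
        -- against the induction hypothesis.
        have hD := hasPartials_aeval x t P
        rw [h0] at hD
        have hz0 : aeval ![x, t] (pderiv 0 P) = 0 := by
          have h1 := wedge_eq hD (HasPartials.snd x t)
          rw [wedge, map_zero, (exteriorPower.ιMulti F 2).map_coord_zero (0 : Fin 2) rfl] at h1
          simpa [h] using h1.symm
        have hz1 : aeval ![x, t] (pderiv 1 P) = 0 := by
          have h1 := wedge_eq hD (HasPartials.fst x t)
          rw [wedge, map_zero, (exteriorPower.ιMulti F 2).map_coord_zero (0 : Fin 2) rfl] at h1
          simpa [h] using h1.symm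
        obtain ⟨i, hi⟩ := exists_pderiv_ne_zero hd
        have hlt := totalDegree_pderiv_lt hi
        refine hi (ih _ (by omega) ?_)
        fin_cases i
        · exact hz0
        · exact hz1
  exact (injective_iff_map_eq_zero _).2 fun P hP => hinj _ P le_rfl hP

end Forms

/-! ### Dominant maps from points that preserve the two-form -/

section Construction

variable {K : Type u} [Field K]

/-- The wedge du ∧ dv is the Jacobian times dx ∧ dt, so equality of the forms becomes the scalar
identity `h`. -/
lemma natForm_eq_of_hasPartials {F : Type u} [Field F] [Algebra K F] {x t y u v r a b c d : F}
    (hy : y ≠ 0) (hr : r ≠ 0) (hu : HasPartials K x t u a b) (hv : HasPartials K x t v c d)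
    (h : (a * d - b * c) * y = r) : natForm K u v r = natForm K x t y := by
  rw [natForm_eq, natForm_eq, wedge_eq hu hv, smul_smul]
  congr 1
  rw [← h] at hr ⊢
  field_simp [left_ne_zero_of_mul hr]

lemma IsDoublePlaneField.aeval_ne_zero {F : Type u} [Field F] [Algebra K F]
    {f : MvPolynomial (Fin 2) K} {p : Fin 3 → F} (hF : IsDoublePlaneField f F p)
    {P : MvPolynomial (Fin 2) K} (v : Fin 2 → K) (hv : eval v P ≠ 0) :
    aeval (σ := Fin 2) ![p 0, p 1] P ≠ 0 := by
  intro h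
  have h0 : P = 0 := hF.indep (h.trans (map_zero _).symm)
  exact hv (by rw [h0, map_zero])

variable {Z Z' : Scheme.{u}} {z : Z ⟶ Spec (.of K)} {z' : Z' ⟶ Spec (.of K)}

/-- A point of one double plane with values in the function field of another one which pulls the
standard two-form back to the standard two-form defines a dominant rational map. -/
lemma exists_dominantMap_of_point [CharZero K] {S : MinimalResolution z} {T : MinimalResolution z'}
    {f g : MvPolynomial (Fin 2) K} {p : Fin 3 → S.FunctionField} {q : Fin 3 → T.FunctionField}
    (hS : IsDoublePlaneField f S.FunctionField p) (hT : IsDoublePlaneField g T.FunctionField q)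
    (hp : p 2 ≠ 0) {r : Fin 3 → S.FunctionField} (hr : OnDoublePlane g r)
    (hform : natForm K (r 0) (r 1) (r 2) = natForm K (p 0) (p 1) (p 2)) :
    ∃ φ : DominantMap S T, (∀ i, φ.comap (q i) = r i) ∧
      φ.pullback (natForm K (q 0) (q 1) (q 2)) = natForm K (p 0) (p 1) (p 2) := by
  -- Dominance comes from the form: the right side of `hform` is nonzero, so r 0 and r 1 are
  -- independent.
  have hw : wedge K (r 0) (r 1) ≠ 0 := by
    intro h
    rw [natForm_eq, natForm_eq, h, smul_zero] at hform
    exact smul_ne_zero (inv_ne_zero hp) hS.wedge_ne_zero hform.symm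
  obtain ⟨φ₀, hφ₀⟩ := hT.lift _ r hr (algebraicIndependent_of_wedge_ne_zero hw)
  obtain ⟨φ, rfl⟩ := exists_dominantMap S T φ₀
  refine ⟨φ, hφ₀, ?_⟩
  rw [← hform]
  refine (pullbackTwoForm_smul_ι φ.comap _ _ _).trans ?_
  rw [map_inv₀, hφ₀, hφ₀, hφ₀]
  rfl

end Construction

/-! ### The equations and Jacobians of the three maps -/

section Formulas

variable {K F : Type u} [Field K] [Field F] [Algebra K F]

/-- In the coordinates w₁, w₂ the branch points 1 and lᵢ become wᵢ = κᵢ² and wᵢ = 0. The functions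
x, x - 1 and x - t split into factors whose product is y² up to a square, and the quadratic factor
is itself a square. -/
lemma pencil_equation_of_kum {a b e₁ e₂ l₁ l₂ r₁ r₂ x₁ x₂ y w₁ w₂ : F} (he₁ : e₁ = 1 - a)
    (he₂ : e₂ = 1 - b) (hl₁ : l₁ * e₁ = 1)
    (hl₂ : l₂ * e₂ = 1) (hr₁ : r₁ = l₁ + l₂ - 2 * l₁ * l₂ - 1)
    (hr₂ : r₂ ^ 2 = (1 - l₁ - l₂) ^ 2) (hw₁ : w₁ = 1 - e₁ * x₁)
    (hw₂ : w₂ = 1 - e₂ * x₂) (hx₁ : x₁ ≠ 0) (hw₁' : w₁ ≠ 0) (hw₂' : w₂ ≠ 0)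
    (hy : y ^ 2 = x₁ * (x₁ ^ 2 + -(1 + l₁) * x₁ + l₁) * (x₂ * (x₂ ^ 2 + -(1 + l₂) * x₂ + l₂)))
    {x t z : F} (hx : x = -(x₂ * (b * w₁ - w₂)) / (e₁ * x₁ * w₂))
    (ht : t = (a * w₂ - w₁) * (b * w₁ - w₂) / (e₁ * e₂ * w₁ * w₂))
    (hz : z = -((b * w₁ - w₂) * (w₁ - w₂) * (b * w₁ ^ 2 - a * w₂ ^ 2) * y) /
        (e₂ * e₁ ^ 2 * x₁ ^ 2 * w₁ ^ 2 * w₂ ^ 3)) :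
    z ^ 2 = x * (x - 1) * (x - t) * (t ^ 2 + 2 * r₁ * t + r₂ ^ 2) := by
  have he₁' : e₁ ≠ 0 := right_ne_zero_of_mul_eq_one hl₁
  have he₂' : e₂ ≠ 0 := right_ne_zero_of_mul_eq_one hl₂
  have hl₁' : l₁ = 1 / e₁ := eq_div_of_mul_eq he₁' hl₁
  have hl₂' : l₂ = 1 / e₂ := eq_div_of_mul_eq he₂' hl₂
  obtain rfl : a = 1 - e₁ := by rw [he₁]; ring
  obtain rfl : b = 1 - e₂ := by rw [he₂]; ring
  have h2 : x - 1 = (w₂ - (1 - e₂)) * (w₁ - w₂) / (e₁ * e₂ * x₁ * w₂) := by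
    rw [hx]
    field_simp
    rw [hw₁, hw₂]
    ring
  have h3 : x - t = -(((1 - e₂) * w₁ - w₂) * (w₁ - (1 - e₁)) * (w₁ - w₂)) /
        (e₁ ^ 2 * e₂ * x₁ * w₁ * w₂) := by
    rw [hx, ht]
    field_simp
    rw [hw₁, hw₂]
    ring
  -- With s = w₁/w₂ one has e₁e₂t - (1 + ab) = -(bs + a/s), and the left side is ((bs + a/s)² -
  -- 4ab)/(e₁e₂)².
  have h4 : t ^ 2 + 2 * r₁ * t + r₂ ^ 2 = ((1 - e₂) * w₁ ^ 2 - (1 - e₁) * w₂ ^ 2) ^ 2 /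
        (e₁ ^ 2 * e₂ ^ 2 * w₁ ^ 2 * w₂ ^ 2) := by
    rw [hr₂, hr₁, hl₁', hl₂', ht]
    field_simp
    ring
  have h5 : y ^ 2 = (e₁ * x₁ * (w₁ - (1 - e₁)) * w₁) * (e₂ * x₂ * (w₂ - (1 - e₂)) * w₂) /
      (e₁ ^ 3 * e₂ ^ 3) := by
    rw [hy, hl₁', hl₂', hw₁, hw₂]
    field_simp
    ring
  rw [h4, h3, h2, hz, hx, div_pow, neg_sq, mul_pow _ y, h5]
  clear h2 h3 h4 h5 hz hx ht hw₁ hw₂ hy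
  -- With the factors opaque, only a cancellation of monomials remains.
  generalize (1 - e₂) * w₁ ^ 2 - (1 - e₁) * w₂ ^ 2 = A
  generalize (1 - e₂) * w₁ - w₂ = B
  generalize w₂ - (1 - e₂) = C
  generalize w₁ - (1 - e₁) = D
  generalize w₁ - w₂ = E
  field_simp

lemma HasPartials.neg {x t u a b : F} (hu : HasPartials K x t u a b) :
    HasPartials K x t (-u) (-a) (-b) := by
  unfold HasPartials at *
  rw [map_neg, hu]
  module

lemma HasPartials.pow {x t u a b : F} (hu : HasPartials K x t u a b) (n : ℕ) :
    HasPartials K x t (u ^ n) (n * u ^ (n - 1) * a) (n * u ^ (n - 1) * b) := by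
  unfold HasPartials at *
  rw [Derivation.leibniz_pow, hu, ← Nat.cast_smul_eq_nsmul F]
  module

lemma HasPartials.congr {x t u a b a' b' : F} (hu : HasPartials K x t u a b) (ha : a = a')
    (hb : b = b') :
    HasPartials K x t u a' b' := ha ▸ hb ▸ hu

/-- Since t depends only on w₁/w₂, both its partial derivatives carry the factor b w₁² - a w₂² that
also occurs in z. -/
lemma pencil_form_of_kum {a b e₁ e₂ x₁ x₂ y w₁ w₂ : F} (he₁ : e₁ = 1 - a)
    (he₂ : e₂ = 1 - b) (he₁' : e₁ ≠ 0) (he₂' : e₂ ≠ 0) (hw₁ : w₁ = 1 - e₁ * x₁)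
    (hw₂ : w₂ = 1 - e₂ * x₂) (hx₁ : x₁ ≠ 0) (hw₁' : w₁ ≠ 0) (hw₂' : w₂ ≠ 0)
    (ha : HasPartials K x₁ x₂ a 0 0) (hb : HasPartials K x₁ x₂ b 0 0)
    {x t z : F} (hx : x = -(x₂ * (b * w₁ - w₂)) / (e₁ * x₁ * w₂))
    (ht : t = (a * w₂ - w₁) * (b * w₁ - w₂) / (e₁ * e₂ * w₁ * w₂))
    (hz : z = -((b * w₁ - w₂) * (w₁ - w₂) * (b * w₁ ^ 2 - a * w₂ ^ 2) * y) /
        (e₂ * e₁ ^ 2 * x₁ ^ 2 * w₁ ^ 2 * w₂ ^ 3)) (hy : y ≠ 0) (hz0 : z ≠ 0) :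
    natForm K x t z = natForm K x₁ x₂ y := by
  have h1 : HasPartials K x₁ x₂ (1 : F) 0 0 := by simpa using HasPartials.natCast (K := K) x₁ x₂ 1
  have hE₁ : HasPartials K x₁ x₂ e₁ 0 0 := by simpa [he₁] using h1.sub ha
  have hE₂ : HasPartials K x₁ x₂ e₂ 0 0 := by simpa [he₂] using h1.sub hb
  have hW₁ : HasPartials K x₁ x₂ w₁ (-e₁) 0 := by
    simpa [hw₁] using h1.sub (hE₁.mul (.fst x₁ x₂))
  have hW₂ : HasPartials K x₁ x₂ w₂ 0 (-e₂) := by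
    simpa [hw₂] using h1.sub (hE₂.mul (.snd x₁ x₂))
  have hX : HasPartials K x₁ x₂ x (x₂ * (b - w₂) / (e₁ * x₁ ^ 2 * w₂))
     ((w₂ ^ 2 - b * w₁) / (e₁ * x₁ * w₂ ^ 2)) := by
    rw [hx]
    refine ((((HasPartials.snd x₁ x₂).mul ((hb.mul hW₁).sub hW₂)).neg).div
      ((hE₁.mul (.fst x₁ x₂)).mul hW₂)).congr ?_ ?_
    · field_simp
      rw [hw₁, he₁]
      ring
    · field_simp
      simp only [hw₁, hw₂]
      ring
  have hT : HasPartials K x₁ x₂ t ((b * w₁ ^ 2 - a * w₂ ^ 2) / (e₂ * w₁ ^ 2 * w₂))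
     (-(b * w₁ ^ 2 - a * w₂ ^ 2) / (e₁ * w₁ * w₂ ^ 2)) := by
    rw [ht]
    refine ((((ha.mul hW₂).sub hW₁).mul ((hb.mul hW₁).sub hW₂)).div
      (((hE₁.mul hE₂).mul hW₁).mul hW₂)).congr ?_ ?_
    · field_simp
      ring
    · field_simp
      ring
  refine natForm_eq_of_hasPartials hy hz0 hX hT ?_
  rw [hz]
  field_simp
  simp only [hw₁, hw₂, he₁, he₂]
  ring

/-- On one curve y²/s² = 4(r - l) for r = (s + 1)²/(4s), so r is a coordinate on the quotient by (0,
0), with ordinate y(1 - s²)/(8s²). The product of two ordinates has denominator 64; the 16 in z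
makes it four times larger, hence the factor 2⁴. -/
lemma legendre_equation_of_isogenous [CharZero F] {l₁ l₂ x₁ x₂ y : F} (hx₁ : x₁ ≠ 0)
    (hx₂ : x₂ ≠ 0)
    (hy : y ^ 2 = x₁ * (x₁ ^ 2 + 2 * (1 - 2 * l₁) * x₁ + 1) *
      (x₂ * (x₂ ^ 2 + 2 * (1 - 2 * l₂) * x₂ + 1)))
    {x t z : F} (hx : x = (x₁ + 1) ^ 2 / (4 * x₁)) (ht : t = (x₂ + 1) ^ 2 / (4 * x₂))
    (hz : z = y * (1 - x₁ ^ 2) * (1 - x₂ ^ 2) / (16 * x₁ ^ 2 * x₂ ^ 2)) :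
    z ^ 2 = 2 ^ 4 * (x * (x ^ 2 + -(1 + l₁) * x + l₁) * (t * (t ^ 2 + -(1 + l₂) * t + l₂))) := by
  have key : ∀ {l s r : F}, s ≠ 0 → r = (s + 1) ^ 2 / (4 * s) →
      r * (r ^ 2 + -(1 + l) * r + l) =
        (1 - s ^ 2) ^ 2 * (s * (s ^ 2 + 2 * (1 - 2 * l) * s + 1)) / (64 * s ^ 4) := by
    rintro l s r hs rfl
    field_simp
    ring
  rw [key hx₁ hx, key hx₂ ht, hz, div_pow, mul_pow, mul_pow, hy,
    div_mul_div_comm, ← mul_div_assoc]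
  field_simp
  ring

/-- Each dr = (s² - 1)/(4s²) ds contributes a 4 to the denominator, which is why z has 16. -/
lemma legendre_form_of_isogenous [CharZero F] {x₁ x₂ y : F} (hx₁ : x₁ ≠ 0) (hx₂ : x₂ ≠ 0)
    {x t z : F} (hx : x = (x₁ + 1) ^ 2 / (4 * x₁)) (ht : t = (x₂ + 1) ^ 2 / (4 * x₂))
    (hz : z = y * (1 - x₁ ^ 2) * (1 - x₂ ^ 2) / (16 * x₁ ^ 2 * x₂ ^ 2))
    (hy : y ≠ 0) (hz0 : z ≠ 0) : natForm K x t z = natForm K x₁ x₂ y := by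
  have h1' : HasPartials K x₁ x₂ (1 : F) 0 0 := by simpa using HasPartials.natCast (K := K) x₁ x₂ 1
  have h4' : HasPartials K x₁ x₂ (4 : F) 0 0 := by simpa using HasPartials.natCast (K := K) x₁ x₂ 4
  have hX : HasPartials K x₁ x₂ x ((x₁ ^ 2 - 1) / (4 * x₁ ^ 2)) 0 := by
    rw [hx]
    refine ((((HasPartials.fst x₁ x₂).add h1').pow 2).div (h4'.mul (.fst x₁ x₂))).congr ?_ ?_
    · norm_num
      field_simp
      ring
    · simp
  have hT : HasPartials K x₁ x₂ t 0 ((x₂ ^ 2 - 1) / (4 * x₂ ^ 2)) := by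
    rw [ht]
    refine ((((HasPartials.snd x₁ x₂).add h1').pow 2).div (h4'.mul (.snd x₁ x₂))).congr ?_ ?_
    · simp
    · norm_num
      field_simp
      ring
  refine natForm_eq_of_hasPartials hy hz0 hX hT ?_
  rw [hz]
  field_simp
  ring

/-- After homogenising and clearing lᵢ = 1/eᵢ, both quadratics have the shape eX² - 2(2 - e)XY +
eY². The first is evaluated at (N, D), the second at (x(x - 1)D, (x - t)N); `hA` and `hB` compute
these values, with the common factor G. -/
lemma isogenous_equation_of_pencil {a k e₁ e₂ l₁ l₂ r₁ r₂ x t y : F} (he₁ : e₁ = 1 - a)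
    (he₂ : e₂ = 1 - k ^ 2) (hl₁ : l₁ * e₁ = 1)
    (hl₂ : l₂ * e₂ = 1) (hr₁ : r₁ = l₁ + l₂ - 2 * l₁ * l₂ - 1)
    (hr₂ : r₂ ^ 2 = (1 - l₁ - l₂) ^ 2)
    (hy : y ^ 2 = x * (x - 1) * (x - t) * (t ^ 2 + 2 * r₁ * t + r₂ ^ 2))
    {P Q c N D G : F} (hP : P = x * (x - 1) * (1 + k)) (hQ : Q = (x - t) * (1 - k))
    (hc : c = e₁ * e₂ * t - (1 + a * k ^ 2))
    (hN : N = c * P + k * (P * (1 + a) - e₁ * Q)) (hD : D = c * Q + k * (e₁ * P - (1 + a) * Q))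
    (hG : G = P ^ 2 * e₁ - 2 * P * Q * (1 + a) + e₁ * Q ^ 2)
    (hxt : x - t ≠ 0) (hN0 : N ≠ 0) (hD0 : D ≠ 0)
    {x₁ x₂ z : F} (hx₁ : x₁ = N / D) (hx₂ : x₂ = x * (x - 1) * D / ((x - t) * N))
    (hz : z = -(k * e₁ * e₂ * G * (x ^ 2 - 2 * t * x + t) * y) / ((x - t) ^ 2 * N * D)) :
    z ^ 2 = x₁ * (x₁ ^ 2 + 2 * (1 - 2 * l₁) * x₁ + 1) *
      (x₂ * (x₂ ^ 2 + 2 * (1 - 2 * l₂) * x₂ + 1)) := by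
  have he₁' : e₁ ≠ 0 := right_ne_zero_of_mul_eq_one hl₁
  have he₂' : e₂ ≠ 0 := right_ne_zero_of_mul_eq_one hl₂
  have hl₁' : l₁ = 1 / e₁ := eq_div_of_mul_eq he₁' hl₁
  have hl₂' : l₂ = 1 / e₂ := eq_div_of_mul_eq he₂' hl₂
  have hq : t ^ 2 + 2 * r₁ * t + r₂ ^ 2 = (c ^ 2 - 4 * a * k ^ 2) / (e₁ ^ 2 * e₂ ^ 2) := by
    rw [hr₂, hr₁, hl₁', hl₂', hc]
    field_simp
    rw [he₁, he₂]
    ring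
  -- The vector (N, D) is (c + kJ)(P, Q) for J with rows (1 + a, -e₁) and (e₁, -(1 + a)). Here J² =
  -- 4a and J is skew for the quadratic form, so the form is multiplied by the norm c² - 4ak².
  have hA : e₁ * N ^ 2 - 2 * (1 + a) * N * D + e₁ * D ^ 2 = (c ^ 2 - 4 * a * k ^ 2) * G := by
    rw [hN, hD, hG, he₁]
    ring
  -- The form factors as ((1 + k)X - (1 - k)Y)((1 - k)X - (1 + k)Y). The first factor is PD - QN =
  -- kG, the second is k e₁e₂ (x² - 2tx + t)².
  have hB : e₂ * (x * (x - 1)) ^ 2 * D ^ 2 - 2 * (1 + k ^ 2) * (x * (x - 1)) * (x - t) * N * D +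
      e₂ * (x - t) ^ 2 * N ^ 2 = k ^ 2 * e₁ * e₂ * G * (x ^ 2 - 2 * t * x + t) ^ 2 := by
    rw [hN, hD, hG, hc, hP, hQ, he₁, he₂]
    ring
  have h1 : x₁ ^ 2 + 2 * (1 - 2 * l₁) * x₁ + 1 = (c ^ 2 - 4 * a * k ^ 2) * G / (e₁ * D ^ 2) := by
    rw [← hA, hx₁, hl₁']
    field_simp
    rw [he₁]
    ring
  have h2 : x₂ ^ 2 + 2 * (1 - 2 * l₂) * x₂ + 1 =
      k ^ 2 * e₁ * e₂ * G * (x ^ 2 - 2 * t * x + t) ^ 2 / (e₂ * (x - t) ^ 2 * N ^ 2) := by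
    rw [← hB, hx₂, hl₂']
    field_simp
    rw [he₂]
    ring
  rw [h1, h2, hx₁, hx₂, hz, div_pow, neg_sq, mul_pow _ y, hy, hq]
  clear * - he₁' he₂' hxt hN0 hD0
  generalize x - t = v at *
  generalize c ^ 2 - 4 * a * k ^ 2 = q
  generalize x ^ 2 - 2 * t * x + t = M
  generalize x - 1 = w
  field_simp

/-- Because x₁x₂ = x(x - 1)/(x - t), the form dx₁ ∧ dx₂ is x₁⁻¹ dx₁ ∧ d(x(x - 1)/(x - t)), and the
last differential is ((x² - 2tx + t) dx + x(x - 1) dt)/(x - t)². -/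
lemma isogenous_form_of_pencil {a k e₁ e₂ x t y : F} (he₁ : e₁ = 1 - a) (he₂ : e₂ = 1 - k ^ 2)
    (ha : HasPartials K x t a 0 0) (hk : HasPartials K x t k 0 0)
    {P Q c N D G : F} (hP : P = x * (x - 1) * (1 + k)) (hQ : Q = (x - t) * (1 - k))
    (hc : c = e₁ * e₂ * t - (1 + a * k ^ 2))
    (hN : N = c * P + k * (P * (1 + a) - e₁ * Q)) (hD : D = c * Q + k * (e₁ * P - (1 + a) * Q))
    (hG : G = P ^ 2 * e₁ - 2 * P * Q * (1 + a) + e₁ * Q ^ 2)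
    (hxt : x - t ≠ 0) (hN0 : N ≠ 0) (hD0 : D ≠ 0)
    {x₁ x₂ z : F} (hx₁ : x₁ = N / D) (hx₂ : x₂ = x * (x - 1) * D / ((x - t) * N))
    (hz : z = -(k * e₁ * e₂ * G * (x ^ 2 - 2 * t * x + t) * y) / ((x - t) ^ 2 * N * D))
    (hy : y ≠ 0) (hz0 : z ≠ 0) : natForm K x₁ x₂ z = natForm K x t y := by
  have h1 : HasPartials K x t (1 : F) 0 0 := by simpa using HasPartials.natCast (K := K) x t 1
  have hE₁ : HasPartials K x t e₁ 0 0 := by simpa [he₁] using h1.sub ha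
  have hE₂ : HasPartials K x t e₂ 0 0 := by simpa [he₂] using h1.sub (hk.pow 2)
  have hX := HasPartials.fst (K := K) x t
  have hT := HasPartials.snd (K := K) x t
  have hU : HasPartials K x t (x * (x - 1)) (2 * x - 1) 0 :=
    (hX.mul (hX.sub h1)).congr (by ring) (by ring)
  have hV : HasPartials K x t (x - t) 1 (-1) := (hX.sub hT).congr (by ring) (by ring)
  have hP' : HasPartials K x t P ((2 * x - 1) * (1 + k)) 0 := by
    rw [hP]
    exact (hU.mul (h1.add hk)).congr (by ring) (by ring)
  have hQ' : HasPartials K x t Q (1 - k) (-(1 - k)) := by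
    rw [hQ]
    exact (hV.mul (h1.sub hk)).congr (by ring) (by ring)
  have hC : HasPartials K x t c 0 (e₁ * e₂) := by
    rw [hc]
    exact (((hE₁.mul hE₂).mul hT).sub (h1.add (ha.mul (hk.pow 2)))).congr (by ring) (by ring)
  obtain ⟨Nx, hNx⟩ : ∃ Nx, Nx = c * ((2 * x - 1) * (1 + k)) +
      k * ((2 * x - 1) * (1 + k) * (1 + a) - e₁ * (1 - k)) := ⟨_, rfl⟩
  obtain ⟨Nt, hNt⟩ : ∃ Nt, Nt = e₁ * e₂ * P + k * e₁ * (1 - k) := ⟨_, rfl⟩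
  obtain ⟨Dx, hDx⟩ : ∃ Dx, Dx = c * (1 - k) +
      k * (e₁ * ((2 * x - 1) * (1 + k)) - (1 + a) * (1 - k)) := ⟨_, rfl⟩
  obtain ⟨Dt, hDt⟩ : ∃ Dt, Dt = e₁ * e₂ * Q - c * (1 - k) + k * (1 + a) * (1 - k) := ⟨_, rfl⟩
  have hN' : HasPartials K x t N Nx Nt := by
    rw [hN, hNx, hNt]
    exact ((hC.mul hP').add (hk.mul ((hP'.mul (h1.add ha)).sub (hE₁.mul hQ')))).congr
      (by ring) (by ring)
  have hD' : HasPartials K x t D Dx Dt := by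
    rw [hD, hDx, hDt]
    exact ((hC.mul hQ').add (hk.mul ((hE₁.mul hP').sub ((h1.add ha).mul hQ')))).congr
      (by ring) (by ring)
  -- Up to denominators this is the Jacobian of N/D against x(x - 1)/(x - t).
  have key : (Nx * D - N * Dx) * (x * (x - 1)) - (Nt * D - N * Dt) * (x ^ 2 - 2 * t * x + t) =
      -(k * e₁ * e₂ * G * (x ^ 2 - 2 * t * x + t)) := by
    rw [hNx, hNt, hDx, hDt, hN, hD, hG, hc, hP, hQ, he₁, he₂]
    ring
  have hX₁ : HasPartials K x t x₁ ((Nx * D - N * Dx) / D ^ 2) ((Nt * D - N * Dt) / D ^ 2) :=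
    hx₁ ▸ hN'.div hD'
  have hX₂ := (hU.mul hD').div (hV.mul hN')
  rw [← hx₂] at hX₂
  refine natForm_eq_of_hasPartials hy hz0 hX₁ hX₂ ?_
  rw [hz, neg_mul_eq_neg_mul, ← key]
  clear * - hxt hN0 hD0
  have hM : x ^ 2 - 2 * t * x + t = (2 * x - 1) * (x - t) - x * (x - 1) := by ring
  rw [hM]
  generalize x - t = v at *
  generalize x * (x - 1) = u
  generalize 2 * x - 1 = w
  field_simp
  ring

end Formulas

/-! ### Coordinate formulas over an arbitrary commutative ring -/

section Maps

variable {R A : Type*} [CommRing R] [CommRing A]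

/-- Numerators of the map from the Kummer surface to the twisted Legendre pencil. -/
def kumToPencilNum (v : Fin 5 → R) : Fin 3 → R :=
  let w₁ := 1 - (1 - v 0 ^ 2) * v 2
  let w₂ := 1 - (1 - v 1 ^ 2) * v 3
  ![-(v 3 * (v 1 ^ 2 * w₁ - w₂)), (v 0 ^ 2 * w₂ - w₁) * (v 1 ^ 2 * w₁ - w₂),
    -((v 1 ^ 2 * w₁ - w₂) * (w₁ - w₂) * (v 1 ^ 2 * w₁ ^ 2 - v 0 ^ 2 * w₂ ^ 2) * v 4)]

/-- Denominators of the map from the Kummer surface to the twisted Legendre pencil. -/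
def kumToPencilDen (v : Fin 5 → R) : Fin 3 → R :=
  let e₁ := 1 - v 0 ^ 2
  let e₂ := 1 - v 1 ^ 2
  let w₁ := 1 - e₁ * v 2
  let w₂ := 1 - e₂ * v 3
  ![e₁ * v 2 * w₂, e₁ * e₂ * w₁ * w₂, e₂ * e₁ ^ 2 * v 2 ^ 2 * w₁ ^ 2 * w₂ ^ 3]

/-- The numerator of the first coordinate of the map from the twisted Legendre pencil to the
isogenous Kummer surface. -/
def pencilNum (v : Fin 5 → R) : R :=
  let e₁ := 1 - v 0 ^ 2
  let P := v 2 * (v 2 - 1) * (1 + v 1)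
  ((e₁ * (1 - v 1 ^ 2) * v 3 - (1 + v 0 ^ 2 * v 1 ^ 2)) * P +
    v 1 * (P * (1 + v 0 ^ 2) - e₁ * ((v 2 - v 3) * (1 - v 1))))

/-- The denominator of the first coordinate of the map from the twisted Legendre pencil to the
isogenous Kummer surface. -/
def pencilDen (v : Fin 5 → R) : R :=
  let e₁ := 1 - v 0 ^ 2
  let Q := (v 2 - v 3) * (1 - v 1)
  ((e₁ * (1 - v 1 ^ 2) * v 3 - (1 + v 0 ^ 2 * v 1 ^ 2)) * Q +
    v 1 * (e₁ * (v 2 * (v 2 - 1) * (1 + v 1)) - (1 + v 0 ^ 2) * Q))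

/-- The quadratic form that divides the third coordinate of the map from the twisted Legendre pencil
to the isogenous Kummer surface. -/
def pencilQuadratic (v : Fin 5 → R) : R :=
  let e₁ := 1 - v 0 ^ 2
  let P := v 2 * (v 2 - 1) * (1 + v 1)
  let Q := (v 2 - v 3) * (1 - v 1)
  P ^ 2 * e₁ - 2 * P * Q * (1 + v 0 ^ 2) + e₁ * Q ^ 2

/-- Numerators of the map from the twisted Legendre pencil to the isogenous Kummer surface. -/
def pencilToIsogenousNum (v : Fin 5 → R) : Fin 3 → R :=
  ![pencilNum v, v 2 * (v 2 - 1) * pencilDen v,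
    -(v 1 * (1 - v 0 ^ 2) * (1 - v 1 ^ 2) * pencilQuadratic v *
      (v 2 ^ 2 - 2 * v 3 * v 2 + v 3) * v 4)]

/-- Denominators of the map from the twisted Legendre pencil to the isogenous Kummer surface. -/
def pencilToIsogenousDen (v : Fin 5 → R) : Fin 3 → R :=
  ![pencilDen v, (v 2 - v 3) * pencilNum v, (v 2 - v 3) ^ 2 * pencilNum v * pencilDen v]

/-- Numerators of the map `xᵢ ↦ (xᵢ + 1)² / (4 xᵢ)` of Kummer surfaces. -/
def isogenousToKumNum (v : Fin 5 → R) : Fin 3 → R :=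
  ![(v 2 + 1) ^ 2, (v 3 + 1) ^ 2, v 4 * (1 - v 2 ^ 2) * (1 - v 3 ^ 2)]

/-- Denominators of the map `xᵢ ↦ (xᵢ + 1)² / (4 xᵢ)` of Kummer surfaces. -/
def isogenousToKumDen (v : Fin 5 → R) : Fin 3 → R :=
  ![4 * v 2, 4 * v 3, 16 * v 2 ^ 2 * v 3 ^ 2]

variable (φ : R →+* A) (v : Fin 5 → R) (i : Fin 3)

/-- Naturality, here and in the next five lemmas, lets one formula serve both as a polynomial over ℚ
and as its value in a function field. -/
lemma map_kumToPencilNum : φ (kumToPencilNum v i) = kumToPencilNum (φ ∘ v) i := by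
  fin_cases i <;> simp [kumToPencilNum]

lemma map_kumToPencilDen : φ (kumToPencilDen v i) = kumToPencilDen (φ ∘ v) i := by
  fin_cases i <;> simp [kumToPencilDen]

lemma map_pencilToIsogenousNum : φ (pencilToIsogenousNum v i) = pencilToIsogenousNum (φ ∘ v) i := by
  fin_cases i <;>
    simp [pencilToIsogenousNum, pencilNum, pencilDen, pencilQuadratic, _root_.map_ofNat φ]

lemma map_pencilToIsogenousDen : φ (pencilToIsogenousDen v i) = pencilToIsogenousDen (φ ∘ v) i := by
  fin_cases i <;> simp [pencilToIsogenousDen, pencilNum, pencilDen]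

lemma map_isogenousToKumNum : φ (isogenousToKumNum v i) = isogenousToKumNum (φ ∘ v) i := by
  fin_cases i <;> simp [isogenousToKumNum]

lemma map_isogenousToKumDen : φ (isogenousToKumDen v i) = isogenousToKumDen (φ ∘ v) i := by
  fin_cases i <;> simp [isogenousToKumDen, _root_.map_ofNat φ]

end Maps

/-! ### Specialisation of the universal formulas -/

section Families

variable {K F : Type u} [Field K] [CharZero K] [Field F] [Algebra K F]

/-- The point with coordinates `κ₁, κ₂, x`. -/
def familyPoint (κ₁ κ₂ : K) (x : Fin 3 → F) : Fin 5 → F :=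
  ![algebraMap K F κ₁, algebraMap K F κ₂, x 0, x 1, x 2]

lemma exists_evalFamily_eq (κ₁ κ₂ : K) (x : Fin 3 → F) :
    ∃ φ : MvPolynomial (Fin 5) ℚ →+* F, φ ∘ X = familyPoint κ₁ κ₂ x ∧
      ∀ P, evalFamily κ₁ κ₂ x P = φ P :=
  ⟨eval₂Hom ((algebraMap K F).comp (algebraMap ℚ K)) (familyPoint κ₁ κ₂ x),
    funext fun _ => eval₂Hom_X' _ _ _, fun _ => rfl⟩

end Families

/-! ### Nonvanishing and the three points -/

section Points

lemma IsDoublePlaneField.apply_two_ne_zero {K F : Type u} [Field K] [Field F] [Algebra K F]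
    {f : MvPolynomial (Fin 2) K} {p : Fin 3 → F} (hF : IsDoublePlaneField f F p)
    {i : Fin 2} (hf : Odd (degreeOf i f)) : p 2 ≠ 0 := by
  intro h
  have h0 : aeval ![p 0, p 1] f = 0 := by
    rw [← hF.mem, h, zero_pow two_ne_zero]
  have h1 : f = 0 := hF.indep (h0.trans (map_zero _).symm)
  rw [h1, degreeOf_zero] at hf
  exact Nat.not_odd_zero hf

variable {K F : Type u} [Field K] [CharZero K] [Field F] [Algebra K F] {p : Fin 3 → F}

lemma isogenousToKum_point {Λ₁ Λ₂ : K} (κ₁ κ₂ : K)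
    (hF : IsDoublePlaneField (kumPoly (isogenousCurve Λ₁) (isogenousCurve Λ₂) 1) F p)
    {n d : Fin 3 → F} (hn : n = isogenousToKumNum (familyPoint κ₁ κ₂ p))
    (hd : d = isogenousToKumDen (familyPoint κ₁ κ₂ p)) :
    (∀ i, d i ≠ 0) ∧
      OnDoublePlane (kumPoly (legendreCurve Λ₁) (legendreCurve Λ₂) (2 ^ 4)) (fun i => n i / d i) ∧
      natForm K (n 0 / d 0) (n 1 / d 1) (n 2 / d 2) = natForm K (p 0) (p 1) (p 2) := by
  have hp := hF.apply_two_ne_zero (kumPoly_degreeOf _ _ one_ne_zero)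
  have hchar : CharZero F := charZero_of_injective_algebraMap (algebraMap K F).injective
  have hy := onDoublePlane_kumPoly.1 hF.mem
  have hx₁ : p 0 ≠ 0 := by
    simpa using hF.aeval_ne_zero (P := X 0) ![1, 1] (by simp)
  have hx₂ : p 1 ≠ 0 := by
    simpa using hF.aeval_ne_zero (P := X 1) ![1, 1] (by simp)
  have hx₁' : 1 - p 0 ^ 2 ≠ 0 := by
    have h := hF.aeval_ne_zero (P := 1 - X 0 ^ 2) ![0, 0] (by simp)
    rw [map_sub] at h
    simpa using h
  have hx₂' : 1 - p 1 ^ 2 ≠ 0 := by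
    have h := hF.aeval_ne_zero (P := 1 - X 1 ^ 2) ![0, 0] (by simp)
    rw [map_sub] at h
    simpa using h
  have hd2 : 16 * p 0 ^ 2 * p 1 ^ 2 ≠ 0 :=
    mul_ne_zero (mul_ne_zero (by norm_num) (pow_ne_zero _ hx₁)) (pow_ne_zero _ hx₂)
  refine ⟨?_, ?_, ?_⟩
  · intro i
    rw [hd]
    fin_cases i
    · exact mul_ne_zero (by norm_num : (4 : F) ≠ 0) hx₁
    · exact mul_ne_zero (by norm_num : (4 : F) ≠ 0) hx₂
    · exact hd2
  · rw [onDoublePlane_kumPoly, hn, hd]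
    have := legendre_equation_of_isogenous (l₁ := algebraMap K _ Λ₁) (l₂ := algebraMap K _ Λ₂)
      hx₁ hx₂ (by simpa [isogenousCurve, _root_.map_ofNat (algebraMap K F)] using hy) rfl rfl rfl
    simpa [isogenousToKumNum, isogenousToKumDen, familyPoint, legendreCurve,
      _root_.map_ofNat (algebraMap K F)] using this
  · rw [hn, hd]
    exact legendre_form_of_isogenous hx₁ hx₂ rfl rfl rfl hp
      (div_ne_zero (mul_ne_zero (mul_ne_zero hp hx₁') hx₂') hd2)

lemma kumToPencil_point {κ₁ κ₂ Λ₁ Λ₂ ρ₁ ρ₂ : K} (hκ₁ : κ₁ ≠ 0)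
    (hΛ₁ : Λ₁ * (1 - κ₁ ^ 2) = 1) (hΛ₂ : Λ₂ * (1 - κ₂ ^ 2) = 1)
    (hρ₁ : ρ₁ = Λ₁ + Λ₂ - 2 * Λ₁ * Λ₂ - 1) (hρ₂ : ρ₂ ^ 2 = (1 - Λ₁ - Λ₂) ^ 2)
    (hF : IsDoublePlaneField (kumPoly (legendreCurve Λ₁) (legendreCurve Λ₂) 1) F p)
    {n d : Fin 3 → F} (hn : n = kumToPencilNum (familyPoint κ₁ κ₂ p))
    (hd : d = kumToPencilDen (familyPoint κ₁ κ₂ p)) :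
    (∀ i, d i ≠ 0) ∧ OnDoublePlane (pencilPoly ρ₁ ρ₂) (fun i => n i / d i) ∧
      natForm K (n 0 / d 0) (n 1 / d 1) (n 2 / d 2) = natForm K (p 0) (p 1) (p 2) := by
  have hp := hF.apply_two_ne_zero (kumPoly_degreeOf _ _ one_ne_zero)
  have hy := onDoublePlane_kumPoly.1 hF.mem
  have hκe₁ : 1 - κ₁ ^ 2 ≠ 0 := right_ne_zero_of_mul_eq_one hΛ₁
  have hκe₂ : 1 - κ₂ ^ 2 ≠ 0 := right_ne_zero_of_mul_eq_one hΛ₂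
  have hz₁ : 1 - (1 - κ₁ ^ 2) * Λ₁ = 0 := by rw [mul_comm, hΛ₁, sub_self]
  obtain ⟨k₁, hk₁⟩ : ∃ k, k = algebraMap K F κ₁ := ⟨_, rfl⟩
  obtain ⟨k₂, hk₂⟩ : ∃ k, k = algebraMap K F κ₂ := ⟨_, rfl⟩
  obtain ⟨e₁, he₁⟩ : ∃ e, e = 1 - k₁ ^ 2 := ⟨_, rfl⟩
  obtain ⟨e₂, he₂⟩ : ∃ e, e = 1 - k₂ ^ 2 := ⟨_, rfl⟩
  obtain ⟨w₁, hw₁⟩ : ∃ w, w = 1 - e₁ * p 0 := ⟨_, rfl⟩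
  obtain ⟨w₂, hw₂⟩ : ∃ w, w = 1 - e₂ * p 1 := ⟨_, rfl⟩
  have he₁K : e₁ = algebraMap K _ (1 - κ₁ ^ 2) := by simp [he₁, hk₁]
  have he₂K : e₂ = algebraMap K _ (1 - κ₂ ^ 2) := by simp [he₂, hk₂]
  have hl₁ : algebraMap K _ Λ₁ * e₁ = 1 := by rw [he₁K, ← map_mul, hΛ₁, map_one]
  have hl₂ : algebraMap K _ Λ₂ * e₂ = 1 := by rw [he₂K, ← map_mul, hΛ₂, map_one]
  have hr₁ := congrArg (algebraMap K F) hρ₁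
  have hr₂ := congrArg (algebraMap K F) hρ₂
  simp only [map_sub, map_add, map_mul, map_pow, map_one,
    _root_.map_ofNat (algebraMap K F)] at hr₁ hr₂
  have he₁' : e₁ ≠ 0 := right_ne_zero_of_mul_eq_one hl₁
  have he₂' : e₂ ≠ 0 := right_ne_zero_of_mul_eq_one hl₂
  let P₁ : MvPolynomial (Fin 2) K := 1 - C (1 - κ₁ ^ 2) * X 0
  let P₂ : MvPolynomial (Fin 2) K := 1 - C (1 - κ₂ ^ 2) * X 1
  have hP₁ : aeval ![p 0, p 1] P₁ = w₁ := by simp [P₁, hw₁, he₁, hk₁]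
  have hP₂ : aeval ![p 0, p 1] P₂ = w₂ := by simp [P₂, hw₂, he₂, hk₂]
  -- At (Λ₁, 0) one has w₁ = 0 and w₂ = 1, so the three factors below take the values -1, -1 and
  -- -κ₁²; the last needs κ₁ ≠ 0.
  have hQ₁ : eval ![Λ₁, 0] P₁ = 0 := by simpa [P₁] using hz₁
  have hQ₂ : eval ![Λ₁, 0] P₂ = 1 := by simp [P₂]
  have hx₁ : p 0 ≠ 0 := by
    simpa using hF.aeval_ne_zero (P := X 0) ![1, 1] (by simp)
  have hw₁' : w₁ ≠ 0 := hP₁ ▸ hF.aeval_ne_zero ![0, 0] (by simp [P₁])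
  have hw₂' : w₂ ≠ 0 := hP₂ ▸ hF.aeval_ne_zero ![0, 0] (by simp [P₂])
  have hA : k₂ ^ 2 * w₁ - w₂ ≠ 0 := by
    have := hF.aeval_ne_zero (P := C (κ₂ ^ 2) * P₁ - P₂) ![Λ₁, 0] (by simp [hQ₁, hQ₂])
    simpa [hP₁, hP₂, hk₂] using this
  have hB : w₁ - w₂ ≠ 0 := by
    have := hF.aeval_ne_zero (P := P₁ - P₂) ![Λ₁, 0] (by simp [hQ₁, hQ₂])
    simpa [hP₁, hP₂] using this
  have hE : k₂ ^ 2 * w₁ ^ 2 - k₁ ^ 2 * w₂ ^ 2 ≠ 0 := by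
    have := hF.aeval_ne_zero (P := C (κ₂ ^ 2) * P₁ ^ 2 - C (κ₁ ^ 2) * P₂ ^ 2) ![Λ₁, 0]
      (by simp [hQ₁, hQ₂, hκ₁])
    simpa [hP₁, hP₂, hk₁, hk₂] using this
  have hd0 : e₁ * p 0 * w₂ ≠ 0 := mul_ne_zero (mul_ne_zero he₁' hx₁) hw₂'
  have hd1 : e₁ * e₂ * w₁ * w₂ ≠ 0 := mul_ne_zero (mul_ne_zero (mul_ne_zero he₁' he₂') hw₁') hw₂'
  have hd2 : e₂ * e₁ ^ 2 * p 0 ^ 2 * w₁ ^ 2 * w₂ ^ 3 ≠ 0 :=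
    mul_ne_zero (mul_ne_zero (mul_ne_zero (mul_ne_zero he₂' (pow_ne_zero _ he₁'))
      (pow_ne_zero _ hx₁)) (pow_ne_zero _ hw₁')) (pow_ne_zero _ hw₂')
  have hn2 : -((k₂ ^ 2 * w₁ - w₂) * (w₁ - w₂) * (k₂ ^ 2 * w₁ ^ 2 - k₁ ^ 2 * w₂ ^ 2) * p 2) ≠ 0 :=
    neg_ne_zero.2 (mul_ne_zero (mul_ne_zero (mul_ne_zero hA hB) hE) hp)
  have hconst : ∀ k : K, HasPartials K (p 0) (p 1) (algebraMap K _ k ^ 2) 0 0 := fun k => by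
    rw [← map_pow]
    exact HasPartials.const (p 0) (p 1) (k ^ 2)
  have hn' : kumToPencilNum (familyPoint κ₁ κ₂ p) = ![-(p 1 * (k₂ ^ 2 * w₁ - w₂)),
      (k₁ ^ 2 * w₂ - w₁) * (k₂ ^ 2 * w₁ - w₂),
      -((k₂ ^ 2 * w₁ - w₂) * (w₁ - w₂) * (k₂ ^ 2 * w₁ ^ 2 - k₁ ^ 2 * w₂ ^ 2) * p 2)] := by
    rw [hw₁, hw₂, he₁, he₂, hk₁, hk₂]
    rfl
  have hd' : kumToPencilDen (familyPoint κ₁ κ₂ p) = ![e₁ * p 0 * w₂, e₁ * e₂ * w₁ * w₂,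
      e₂ * e₁ ^ 2 * p 0 ^ 2 * w₁ ^ 2 * w₂ ^ 3] := by
    rw [hw₁, hw₂, he₁, he₂, hk₁, hk₂]
    rfl
  rw [hn'] at hn
  rw [hd'] at hd
  have hr0 : n 0 / d 0 = -(p 1 * (k₂ ^ 2 * w₁ - w₂)) / (e₁ * p 0 * w₂) := by rw [hn, hd]; rfl
  have hr1 : n 1 / d 1 = (k₁ ^ 2 * w₂ - w₁) * (k₂ ^ 2 * w₁ - w₂) / (e₁ * e₂ * w₁ * w₂) := by
    rw [hn, hd]; rfl
  have hr2 : n 2 / d 2 =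
      -((k₂ ^ 2 * w₁ - w₂) * (w₁ - w₂) * (k₂ ^ 2 * w₁ ^ 2 - k₁ ^ 2 * w₂ ^ 2) * p 2) /
        (e₂ * e₁ ^ 2 * p 0 ^ 2 * w₁ ^ 2 * w₂ ^ 3) := by rw [hn, hd]; rfl
  refine ⟨?_, ?_, ?_⟩
  · intro i
    rw [hd]
    fin_cases i
    · exact hd0
    · exact hd1
    · exact hd2
  · rw [onDoublePlane_pencilPoly]
    exact pencil_equation_of_kum he₁ he₂ hl₁ hl₂ hr₁ hr₂ hw₁ hw₂ hx₁ hw₁' hw₂'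
      (by simpa [legendreCurve] using hy) hr0 hr1 hr2
  · exact pencil_form_of_kum he₁ he₂ he₁' he₂' hw₁ hw₂ hx₁ hw₁' hw₂' (hk₁ ▸ hconst κ₁)
      (hk₂ ▸ hconst κ₂) hr0 hr1 hr2 hp (hr2 ▸ div_ne_zero hn2 hd2)

lemma pencilToIsogenous_point {κ₁ κ₂ Λ₁ Λ₂ ρ₁ ρ₂ : K} (hκ₂ : κ₂ ≠ 0)
    (hΛ₁ : Λ₁ * (1 - κ₁ ^ 2) = 1) (hΛ₂ : Λ₂ * (1 - κ₂ ^ 2) = 1)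
    (hρ₁ : ρ₁ = Λ₁ + Λ₂ - 2 * Λ₁ * Λ₂ - 1) (hρ₂ : ρ₂ ^ 2 = (1 - Λ₁ - Λ₂) ^ 2)
    (hF : IsDoublePlaneField (pencilPoly ρ₁ ρ₂) F p)
    {n d : Fin 3 → F} (hn : n = pencilToIsogenousNum (familyPoint κ₁ κ₂ p))
    (hd : d = pencilToIsogenousDen (familyPoint κ₁ κ₂ p)) :
    (∀ i, d i ≠ 0) ∧
      OnDoublePlane (kumPoly (isogenousCurve Λ₁) (isogenousCurve Λ₂) 1) (fun i => n i / d i) ∧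
      natForm K (n 0 / d 0) (n 1 / d 1) (n 2 / d 2) = natForm K (p 0) (p 1) (p 2) := by
  have hp := hF.apply_two_ne_zero (pencilPoly_degreeOf ρ₁ ρ₂)
  have hy := onDoublePlane_pencilPoly.1 hF.mem
  have hκe₁ : 1 - κ₁ ^ 2 ≠ 0 := right_ne_zero_of_mul_eq_one hΛ₁
  have hκe₂ : 1 - κ₂ ^ 2 ≠ 0 := right_ne_zero_of_mul_eq_one hΛ₂
  have hκp : 1 + κ₂ ≠ 0 := fun h => hκe₂ (by linear_combination (1 - κ₂) * h)
  have hκm : 1 - κ₂ ≠ 0 := fun h => hκe₂ (by linear_combination (1 + κ₂) * h)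
  -- A linear function with slope e₁e₂ ≠ 0 cannot vanish at both A and A + 1. This avoids a case
  -- distinction on κ₁, κ₂ when a test point is chosen.
  have hbr : ∀ A B : K, (1 - κ₁ ^ 2) * (1 - κ₂ ^ 2) * A - B ≠ 0 ∨
      (1 - κ₁ ^ 2) * (1 - κ₂ ^ 2) * (A + 1) - B ≠ 0 := by
    intro A B
    by_contra! h
    exact mul_ne_zero hκe₁ hκe₂ (by linear_combination h.2 - h.1)
  obtain ⟨k₁, hk₁⟩ : ∃ k, k = algebraMap K F κ₁ := ⟨_, rfl⟩
  obtain ⟨k₂, hk₂⟩ : ∃ k, k = algebraMap K F κ₂ := ⟨_, rfl⟩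
  obtain ⟨e₁, he₁⟩ : ∃ e, e = 1 - k₁ ^ 2 := ⟨_, rfl⟩
  obtain ⟨e₂, he₂⟩ : ∃ e, e = 1 - k₂ ^ 2 := ⟨_, rfl⟩
  have he₁K : e₁ = algebraMap K _ (1 - κ₁ ^ 2) := by simp [he₁, hk₁]
  have he₂K : e₂ = algebraMap K _ (1 - κ₂ ^ 2) := by simp [he₂, hk₂]
  have hl₁ : algebraMap K _ Λ₁ * e₁ = 1 := by rw [he₁K, ← map_mul, hΛ₁, map_one]
  have hl₂ : algebraMap K _ Λ₂ * e₂ = 1 := by rw [he₂K, ← map_mul, hΛ₂, map_one]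
  have hr₁ := congrArg (algebraMap K F) hρ₁
  have hr₂ := congrArg (algebraMap K F) hρ₂
  simp only [map_sub, map_add, map_mul, map_pow, map_one,
    _root_.map_ofNat (algebraMap K F)] at hr₁ hr₂
  have he₁' : e₁ ≠ 0 := right_ne_zero_of_mul_eq_one hl₁
  have he₂' : e₂ ≠ 0 := right_ne_zero_of_mul_eq_one hl₂
  have hk₂' : k₂ ≠ 0 := by rw [hk₂]; exact (map_ne_zero _).2 hκ₂
  let θ : MvPolynomial (Fin 2) K →ₐ[K] F := aeval ![p 0, p 1]
  -- The polynomials N, D and G do not involve y, so the last entry is an arbitrary 0.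
  let ξ : Fin 5 → MvPolynomial (Fin 2) K := ![C κ₁, C κ₂, X 0, X 1, 0]
  have hθ : ∀ (P : MvPolynomial (Fin 2) K) (v : Fin 2 → K), MvPolynomial.eval v P ≠ 0 → θ P ≠ 0 :=
    fun P v h => hF.aeval_ne_zero v h
  have hθ0 : θ (X 0) = p 0 := by simp [θ]
  have hθ1 : θ (X 1) = p 1 := by simp [θ]
  have hθC : ∀ k, θ (C k) = algebraMap K F k := fun k => by simp [θ]
  obtain ⟨P, hP⟩ : ∃ P, P = p 0 * (p 0 - 1) * (1 + k₂) := ⟨_, rfl⟩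
  obtain ⟨Q, hQ⟩ : ∃ Q, Q = (p 0 - p 1) * (1 - k₂) := ⟨_, rfl⟩
  obtain ⟨c, hc⟩ : ∃ c, c = e₁ * e₂ * p 1 - (1 + k₁ ^ 2 * k₂ ^ 2) := ⟨_, rfl⟩
  obtain ⟨N, hN⟩ : ∃ N, N = c * P + k₂ * (P * (1 + k₁ ^ 2) - e₁ * Q) := ⟨_, rfl⟩
  obtain ⟨D, hD⟩ : ∃ D, D = c * Q + k₂ * (e₁ * P - (1 + k₁ ^ 2) * Q) := ⟨_, rfl⟩
  obtain ⟨G, hG⟩ : ∃ G, G = P ^ 2 * e₁ - 2 * P * Q * (1 + k₁ ^ 2) + e₁ * Q ^ 2 := ⟨_, rfl⟩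
  have hNθ : θ (pencilNum ξ) = N := by
    simp [ξ, pencilNum, hθ0, hθ1, hθC, hN, hP, hQ, hc, he₁, he₂, hk₁, hk₂]
  have hDθ : θ (pencilDen ξ) = D := by
    simp [ξ, pencilDen, hθ0, hθ1, hθC, hD, hP, hQ, hc, he₁, he₂, hk₁, hk₂]
  have hGθ : θ (pencilQuadratic ξ) = G := by
    simp [ξ, pencilQuadratic, hθ0, hθ1, hθC, hG, hP, hQ, he₁, hk₁, hk₂, _root_.map_ofNat θ]
  have hxt : p 0 - p 1 ≠ 0 := by
    rw [← hθ0, ← hθ1, ← map_sub]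
    exact hθ _ ![1, 0] (by simp)
  have hN0 : N ≠ 0 := by
    rw [← hNθ]
    -- On the diagonal Q = 0 and N = P(c + κ₂(1 + κ₁²)), linear in s apart from P; s = 2 or 3 keeps
    -- s(s - 1) nonzero.
    have key : ∀ s : K, eval ![s, s] (pencilNum ξ) = s * (s - 1) * (1 + κ₂) *
        ((1 - κ₁ ^ 2) * (1 - κ₂ ^ 2) * s - (1 + κ₁ ^ 2 * κ₂ ^ 2 - κ₂ * (1 + κ₁ ^ 2))) := by
      intro s
      simp [ξ, pencilNum]
      ring
    rcases hbr 2 (1 + κ₁ ^ 2 * κ₂ ^ 2 - κ₂ * (1 + κ₁ ^ 2)) with h | h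
    · refine hθ _ ![2, 2] ?_
      rw [key]
      exact mul_ne_zero (mul_ne_zero (by norm_num) hκp) h
    · refine hθ _ ![2 + 1, 2 + 1] ?_
      rw [key]
      exact mul_ne_zero (mul_ne_zero (by norm_num) hκp) h
  have hD0 : D ≠ 0 := by
    rw [← hDθ]
    -- On the line x = 0 one has P = 0 and D = Q(c - κ₂(1 + κ₁²)).
    have key : ∀ s : K, eval ![0, s] (pencilDen ξ) = -s * (1 - κ₂) *
        ((1 - κ₁ ^ 2) * (1 - κ₂ ^ 2) * s - (1 + κ₁ ^ 2 * κ₂ ^ 2 + κ₂ * (1 + κ₁ ^ 2))) := by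
      intro s
      simp [ξ, pencilDen]
      ring
    rcases hbr 1 (1 + κ₁ ^ 2 * κ₂ ^ 2 + κ₂ * (1 + κ₁ ^ 2)) with h | h
    · refine hθ _ ![0, 1] ?_
      rw [key]
      exact mul_ne_zero (mul_ne_zero (by norm_num) hκm) h
    · refine hθ _ ![0, 1 + 1] ?_
      rw [key]
      exact mul_ne_zero (mul_ne_zero (by norm_num) hκm) h
  have hG0 : G ≠ 0 := by
    rw [← hGθ]
    refine hθ _ ![2, 2] ?_
    -- Again Q = 0 on the diagonal, which leaves G = e₁P².
    have h : eval ![2, 2] (pencilQuadratic ξ) = (2 * (1 + κ₂)) ^ 2 * (1 - κ₁ ^ 2) := by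
      simp [ξ, pencilQuadratic]
      exact Or.inl (by ring)
    rw [h]
    exact mul_ne_zero (pow_ne_zero _ (mul_ne_zero two_ne_zero hκp)) hκe₁
  have hM0 : p 0 ^ 2 - 2 * p 1 * p 0 + p 1 ≠ 0 := by
    have h := hθ (X 0 ^ 2 - 2 * X 1 * X 0 + X 1) ![1, 0] (by simp)
    simpa [hθ0, hθ1, _root_.map_ofNat θ] using h
  have hr0 : n 0 / d 0 = N / D := by
    rw [hn, hd, hN, hD, hP, hQ, hc, he₁, he₂, hk₁, hk₂]; rfl
  have hr1 : n 1 / d 1 = p 0 * (p 0 - 1) * D / ((p 0 - p 1) * N) := by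
    rw [hn, hd, hN, hD, hP, hQ, hc, he₁, he₂, hk₁, hk₂]; rfl
  have hr2 : n 2 / d 2 = -(k₂ * e₁ * e₂ * G * (p 0 ^ 2 - 2 * p 1 * p 0 + p 1) * p 2) /
      ((p 0 - p 1) ^ 2 * N * D) := by
    rw [hn, hd, hG, hN, hD, hP, hQ, hc, he₁, he₂, hk₁, hk₂]; rfl
  have hd' : d = ![D, (p 0 - p 1) * N, (p 0 - p 1) ^ 2 * N * D] := by
    rw [hd, hN, hD, hP, hQ, hc, he₁, he₂, hk₁, hk₂]; rfl
  have hd2 : (p 0 - p 1) ^ 2 * N * D ≠ 0 :=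
    mul_ne_zero (mul_ne_zero (pow_ne_zero _ hxt) hN0) hD0
  refine ⟨?_, ?_, ?_⟩
  · intro i
    rw [hd']
    fin_cases i
    · exact hD0
    · exact mul_ne_zero hxt hN0
    · exact hd2
  · rw [onDoublePlane_kumPoly]
    have := isogenous_equation_of_pencil he₁ he₂ hl₁ hl₂ hr₁ hr₂ hy hP hQ hc hN hD hG hxt hN0 hD0
      hr0 hr1 hr2
    simpa [isogenousCurve, _root_.map_ofNat (algebraMap K F)] using this
  · have hconst₁ : HasPartials K (p 0) (p 1) (k₁ ^ 2) 0 0 := by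
      rw [hk₁, ← map_pow]
      exact .const _ _ _
    have hconst₂ : HasPartials K (p 0) (p 1) k₂ 0 0 := hk₂ ▸ .const _ _ _
    refine isogenous_form_of_pencil he₁ he₂ hconst₁ hconst₂ hP hQ hc hN hD hG hxt hN0 hD0
      hr0 hr1 hr2 hp (hr2 ▸ div_ne_zero (neg_ne_zero.2 ?_) hd2)
    exact mul_ne_zero (mul_ne_zero (mul_ne_zero (mul_ne_zero (mul_ne_zero hk₂' he₁') he₂') hG0)
      hM0) hp

end Points

/-! ### Maps given by universal polynomials -/

section Existence

variable {K : Type u} [Field K]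

lemma exists_givenBy [CharZero K] {Z Z' : Scheme.{u}} {z : Z ⟶ Spec (.of K)}
    {z' : Z' ⟶ Spec (.of K)}
    {S : MinimalResolution z} {T : MinimalResolution z'}
    {f g : MvPolynomial (Fin 2) K} {p : Fin 3 → S.FunctionField} {q : Fin 3 → T.FunctionField}
    (hS : IsDoublePlaneField f S.FunctionField p) (hT : IsDoublePlaneField g T.FunctionField q)
    {N D : Fin 3 → MvPolynomial (Fin 5) ℚ} {κ₁ κ₂ : K}
    {n d : Fin 3 → S.FunctionField} (hp : p 2 ≠ 0)
    (hn : ∀ φ : MvPolynomial (Fin 5) ℚ →+* S.FunctionField, φ ∘ X = familyPoint κ₁ κ₂ p →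
      ∀ i, φ (N i) = n i)
    (hd : ∀ φ : MvPolynomial (Fin 5) ℚ →+* S.FunctionField, φ ∘ X = familyPoint κ₁ κ₂ p →
      ∀ i, φ (D i) = d i)
    (hpt : (∀ i, d i ≠ 0) ∧ OnDoublePlane g (fun i => n i / d i) ∧
      natForm K (n 0 / d 0) (n 1 / d 1) (n 2 / d 2) = natForm K (p 0) (p 1) (p 2)) :
    ∃ φ : DominantMap S T, φ.GivenBy κ₁ κ₂ p q N D ∧
      φ.pullback (natForm K (q 0) (q 1) (q 2)) = natForm K (p 0) (p 1) (p 2) := by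
  obtain ⟨hd0, hr, hform⟩ := hpt
  obtain ⟨φ, h, h'⟩ := exists_dominantMap_of_point hS hT hp hr hform
  obtain ⟨θ, hθ, heval⟩ := exists_evalFamily_eq κ₁ κ₂ p
  exact ⟨φ, fun i => ⟨by rw [heval, hd θ hθ]; exact hd0 i,
    by rw [h, heval, heval, hn θ hθ, hd θ hθ]⟩, h'⟩

end Existence

end

end KummerSandwich

theorem mainTheorem7 :
    ∃ N₁ D₁ N₂ D₂ N₃ D₃ : Fin 3 → MvPolynomial (Fin 5) ℚ,
      ∀ (K : Type u) [Field K] [CharZero K] (κ₁ κ₂ Λ₁ Λ₂ ρ₁ ρ₂ : K),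
        Λ₁ = 1 / (1 - κ₁ ^ 2) → Λ₂ = 1 / (1 - κ₂ ^ 2) →
        Λ₁ ≠ 0 → Λ₁ ≠ 1 → Λ₂ ≠ 0 → Λ₂ ≠ 1 →
        ρ₁ = Λ₁ + Λ₂ - 2 * Λ₁ * Λ₂ - 1 → ρ₂ ^ 2 = (1 - Λ₁ - Λ₂) ^ 2 →
        ∀ (S : KummerSandwich.Kum (KummerSandwich.legendreCurve Λ₁)
              (KummerSandwich.legendreCurve Λ₂) 1)
          (X : KummerSandwich.LegendreK3 ρ₁ ρ₂)
          (S' : KummerSandwich.Kum (KummerSandwich.isogenousCurve Λ₁)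
              (KummerSandwich.isogenousCurve Λ₂) 1)
          (St : KummerSandwich.Kum (KummerSandwich.legendreCurve Λ₁)
              (KummerSandwich.legendreCurve Λ₂) (2 ^ 4)),
          ∃ (f₁ : KummerSandwich.DominantMap S X) (f₂ : KummerSandwich.DominantMap X S')
            (f₃ : KummerSandwich.DominantMap S' St),
            f₁.GivenBy κ₁ κ₂ (KummerSandwich.Kum.coords S) (KummerSandwich.LegendreK3.coords X)
              N₁ D₁ ∧
            f₂.GivenBy κ₁ κ₂ (KummerSandwich.LegendreK3.coords X) (KummerSandwich.Kum.coords S')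
              N₂ D₂ ∧
            f₃.GivenBy κ₁ κ₂ (KummerSandwich.Kum.coords S') (KummerSandwich.Kum.coords St)
              N₃ D₃ ∧
            f₁.pullback (KummerSandwich.LegendreK3.form X) = KummerSandwich.Kum.form S ∧
            f₂.pullback (KummerSandwich.Kum.form S') = KummerSandwich.LegendreK3.form X ∧
            f₃.pullback (KummerSandwich.Kum.form St) = KummerSandwich.Kum.form S' := by
  open KummerSandwich in
  refine ⟨kumToPencilNum X, kumToPencilDen X, pencilToIsogenousNum X, pencilToIsogenousDen X,
    isogenousToKumNum X, isogenousToKumDen X, ?_⟩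
  intro K _ _ κ₁ κ₂ Λ₁ Λ₂ ρ₁ ρ₂ hΛ₁ hΛ₂ h₁0 h₁1 h₂0 h₂1 hρ₁ hρ₂ S X₀ S' St
  -- As 1 / 0 = 0, the condition Λ ≠ 0 is what excludes κ² = 1; likewise Λ ≠ 1 excludes κ = 0.
  have hmul : ∀ {κ Λ : K}, Λ = 1 / (1 - κ ^ 2) → Λ ≠ 0 → Λ * (1 - κ ^ 2) = 1 := by
    rintro κ Λ rfl h
    exact one_div_mul_cancel fun h0 => h (by rw [h0, div_zero])
  have hκ : ∀ {κ Λ : K}, Λ = 1 / (1 - κ ^ 2) → Λ ≠ 1 → κ ≠ 0 := by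
    rintro κ Λ rfl h rfl
    exact h (by simp)
  have hS := Kum.isDoublePlaneField one_ne_zero S
  have hX := LegendreK3.isDoublePlaneField X₀
  have hS' := Kum.isDoublePlaneField one_ne_zero S'
  have hSt := Kum.isDoublePlaneField (pow_ne_zero 4 two_ne_zero) St
  obtain ⟨f₁, hf₁, hω₁⟩ := exists_givenBy hS hX (κ₁ := κ₁) (κ₂ := κ₂)
    (hS.apply_two_ne_zero (kumPoly_degreeOf _ _ one_ne_zero))
    (fun φ hφ i => by rw [map_kumToPencilNum, hφ]) (fun φ hφ i => by rw [map_kumToPencilDen, hφ])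
    (kumToPencil_point (hκ hΛ₁ h₁1) (hmul hΛ₁ h₁0) (hmul hΛ₂ h₂0) hρ₁ hρ₂ hS rfl rfl)
  obtain ⟨f₂, hf₂, hω₂⟩ := exists_givenBy hX hS' (κ₁ := κ₁) (κ₂ := κ₂)
    (hX.apply_two_ne_zero (pencilPoly_degreeOf ρ₁ ρ₂))
    (fun φ hφ i => by rw [map_pencilToIsogenousNum, hφ])
    (fun φ hφ i => by rw [map_pencilToIsogenousDen, hφ])
    (pencilToIsogenous_point (hκ hΛ₂ h₂1) (hmul hΛ₁ h₁0) (hmul hΛ₂ h₂0) hρ₁ hρ₂ hX rfl rfl)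
  obtain ⟨f₃, hf₃, hω₃⟩ := exists_givenBy hS' hSt (κ₁ := κ₁) (κ₂ := κ₂)
    (hS'.apply_two_ne_zero (kumPoly_degreeOf _ _ one_ne_zero))
    (fun φ hφ i => by rw [map_isogenousToKumNum, hφ])
    (fun φ hφ i => by rw [map_isogenousToKumDen, hφ])
    (isogenousToKum_point κ₁ κ₂ hS' rfl rfl)
  exact ⟨f₁, f₂, f₃, hf₁, hf₂, hf₃, hω₁, hω₂, hω₃⟩
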